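/- **Theorem (Intrinsic fault-tolerant gate bound).** Let $\{C_\lambda(\mathcal S_\lambda)\}_{\lambda\in I}$ be a family of qubit stabilizer codes with specified generating sets: $\mathcal S_\lambda$ is a set of commuting $n_\lambda$-qubit Pauli operators, $-1\notin\langle\mathcal S_\lambda\rangle$, and $C_\lambda$ is the common $+1$ eigenspace of $\langle\mathcal S_\lambda\rangle$. The connectivity graph $G_\lambda$ has the physical qubits as vertices, two distinct qubits being adjacent iff both lie in the support of some generator in $\mathcal S_\lambda$; every $G_\lambda$ is assumed connected and carries its shortest-path metric. Assume that the family has intrinsic dimension $\beta\in[1,\infty)$, i.e. $\beta$ is the Assouad dimension of $\{G_\lambda\}_{\lambda\in I}$: the infimum of all $\alpha\ge 0$ for which there is a constant $K>0$ such that for all $\lambda\in I$, all vertices $x$ of $G_\lambda$ and all real $0<r<R$, the ball of radius $R$ around $x$ is covered by at most $K(R/r)^\alpha$ balls of radius $r$. Let $\mathcal G=\{\mathcal G_\lambda\}_{\lambda\in I}$ be a graph-local gate set: there is a constant $\eta$ such that for every $\lambda$ and every gate $g\in\mathcal G_\lambda$, any two qubits in the support of $g$ are joined by a path of length at most $\eta$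 in $G_\lambda$. Let $h\in\mathbb N$. Then there is a constant $d_0$ (depending on the code family, the gate set and $h$, but not on $\lambda$) such that the following holds for every $\lambda\in I$ for which $C_\lambda$ encodes $k\ge1$ logical qubits and has code distance $d_\lambda\ge d_0$. Let $U$ be a unitary realized by a circuit of at most $h$ layers over $\mathcal G_\lambda$, each layer a product of gates with pairwise disjoint supports, and suppose that $U$ preserves the code space $C_\lambda$. Let $W:(\mathbb C^2)^{\otimes k}\to(\mathbb C^2)^{\otimes n_\lambda}$ be any encoding, i.e. an isometry with image $C_\lambda$ such that every $k$-qubit Pauli operator $P$ satisfies $P'W=WP$ for some physical Pauli operator $P'$ commuting with $\mathcal S_\lambda$. Then the logical gate $L\in\mathbb U(2^k)$ implemented by $U$, defined by $UW=WL$, belongs to the $\lfloor\beta\rfloor$-th level $\mathcal P_{\lfloor\beta\rfloor}$ of the Clifford hierarchy. Here $\mathcal P_1$ is the $k$-qubit Pauli group (with phases $\pm1,\pm i$) and $\mathcal P_{\ell+1}=\{V\in\mathbb U(2^k) : VPV^\dagger\in\mathcal P_{\ell}\ \text{for all } P\in\mathcal P_1\}$ for $\ell\ge 1$. The code distance is the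 minimal weight of a Pauli operator that commutes with $\mathcal S_\lambda$ and is not a scalar multiple of an element of $\langle\mathcal S_\lambda\rangle$. In particular, if $d_\lambda\to\infty$, the conclusion holds for all codes of the family with sufficiently large distance. -/

import Mathlib

open scoped ENNReal NNReal Matrix

noncomputable section

/-! ## Qubit operators, supports and the Pauli group -/

/-- Operators on the Hilbert space `(ℂ²)^{⊗ Q}` of a finite set `Q` of qubits, as matrices in the
computational basis `Q → Fin 2`. -/
abbrev QubitOp (Q : Type*) := Matrix (Q → Fin 2) (Q → Fin 2) ℂ

/-- The unitary group of `(ℂ²)^{⊗ Q}`. -/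
abbrev QubitUnitary (Q : Type*) [Fintype Q] [DecidableEq Q] :=
  ↥(Matrix.unitaryGroup (Q → Fin 2) ℂ)

/-- `A` acts trivially on the qubit `q`, i.e. `A = A' ⊗ I_q` for some operator `A'` on the remaining
qubits (whose entries are those of `A` at basis states in which the qubit `q` is `0`). -/
def ActsTriviallyOn {Q : Type*} [DecidableEq Q] (A : QubitOp Q) (q : Q) : Prop :=
  ∀ x y : Q → Fin 2,
    A x y = if x q = y q then A (Function.update x q 0) (Function.update y q 0) else 0

/-- The support of an operator: the set of qubits on which it acts non-trivially. -/
def opSupport {Q : Type*} [DecidableEq Q] (A : QubitOp Q) : Set Q :=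
  {q | ¬ ActsTriviallyOn A q}

/-- Labels of the single-qubit Pauli matrices. -/
inductive PauliLabel
  | I
  | X
  | Y
  | Z

/-- The single-qubit Pauli matrices. -/
def PauliLabel.toMatrix : PauliLabel → Matrix (Fin 2) (Fin 2) ℂ
  | .I => 1
  | .X => !![0, 1; 1, 0]
  | .Y => !![0, -Complex.I; Complex.I, 0]
  | .Z => !![1, 0; 0, -1]

/-- The tensor product `⨂_q σ_{p q}` of single-qubit Pauli matrices. -/
def pauliString {Q : Type*} [Fintype Q] (p : Q → PauliLabel) : QubitOp Q :=
  fun x y => ∏ q, (p q).toMatrix (x q) (y q)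

/-- The Pauli group on `Q`: Pauli strings with a phase in `{1, -1, i, -i}`. -/
def pauliGroup (Q : Type*) [Fintype Q] [DecidableEq Q] : Set (QubitUnitary Q) :=
  {U | ∃ c ∈ ({1, -1, Complex.I, -Complex.I} : Set ℂ), ∃ p : Q → PauliLabel,
    (U : QubitOp Q) = c • pauliString p}

/-- The Clifford hierarchy on the qubits `Q`. Level `1` is the Pauli group, and `U` is in level
`ℓ + 1` iff `U P U†` is in level `ℓ` for all Pauli operators `P`. (Levels start at `1`; the value
at `0` is a placeholder.) -/
def cliffordHierarchy (Q : Type*) [Fintype Q] [DecidableEq Q] : ℕ → Set (QubitUnitary Q)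
  | 0 => ∅
  | 1 => pauliGroup Q
  | ℓ + 2 => {U | ∀ P ∈ pauliGroup Q, U * P * U⁻¹ ∈ cliffordHierarchy Q (ℓ + 1)}

/-! ## Stabilizer codes with a specified generating set -/

/-- A stabilizer code on the physical qubits `Q` with a specified (possibly redundant) set of
stabilizer generators: commuting Pauli operators which generate a group not containing `-1`. -/
structure StabilizerCode (Q : Type*) [Fintype Q] [DecidableEq Q] where
  gens : Set (QubitUnitary Q)
  gens_pauli : gens ⊆ pauliGroup Q
  gens_commute : ∀ s ∈ gens, ∀ t ∈ gens, s * t = t * s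
  neg_one_notMem : ∀ s ∈ Subgroup.closure gens, (s : QubitOp Q) ≠ -1

namespace StabilizerCode

variable {Q : Type*} [Fintype Q] [DecidableEq Q]

/-- The stabilizer group. -/
def stabilizer (C : StabilizerCode Q) : Subgroup (QubitUnitary Q) :=
  Subgroup.closure C.gens

/-- The code space: the common `+1` eigenspace of the stabilizer group. -/
def codeSpace (C : StabilizerCode Q) : Submodule ℂ ((Q → Fin 2) → ℂ) where
  carrier := {ψ | ∀ s ∈ C.stabilizer, (s : QubitOp Q) *ᵥ ψ = ψ}
  zero_mem' := fun s _ => Matrix.mulVec_zero (s : QubitOp Q)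
  add_mem' := fun {a b} ha hb s hs => by rw [Matrix.mulVec_add, ha s hs, hb s hs]
  smul_mem' := fun c a ha s hs => by rw [Matrix.mulVec_smul, ha s hs]

/-- Logical Pauli operators: the Pauli operators commuting with all stabilizers. -/
def logicalPaulis (C : StabilizerCode Q) : Set (QubitUnitary Q) :=
  {P | P ∈ pauliGroup Q ∧ ∀ s ∈ C.gens, P * s = s * P}

/-- Nontrivial logical Pauli operators: those which are not a stabilizer up to a phase. -/
def nontrivialLogicalPaulis (C : StabilizerCode Q) : Set (QubitUnitary Q) :=
  {P | P ∈ C.logicalPaulis ∧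
    ¬ ∃ c : ℂ, ∃ s ∈ C.stabilizer, (P : QubitOp Q) = c • (s : QubitOp Q)}

/-- The code distance: the minimal weight of a nontrivial logical Pauli operator. -/
def distance (C : StabilizerCode Q) : ℕ :=
  sInf ((fun P : QubitUnitary Q => (opSupport (P : QubitOp Q)).ncard) '' C.nontrivialLogicalPaulis)

/-- The connectivity graph: two distinct qubits are adjacent iff they both lie in the support of
some stabilizer generator. -/
def connectivityGraph (C : StabilizerCode Q) : SimpleGraph Q where
  Adj u v := u ≠ v ∧ ∃ s ∈ C.gens, u ∈ opSupport (s : QubitOp Q) ∧ v ∈ opSupport (s : QubitOp Q)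
  symm := ⟨fun _ _ ⟨h, s, hs, hu, hv⟩ => ⟨h.symm, s, hs, hv, hu⟩⟩
  loopless := ⟨fun _ h => h.1 rfl⟩

/-- A unitary is a logical gate if it maps the code space onto itself. -/
def IsLogicalGate (C : StabilizerCode Q) (U : QubitUnitary Q) : Prop :=
  C.codeSpace.map (Matrix.mulVecLin (U : QubitOp Q)) = C.codeSpace

/-- An encoding of `k` logical qubits: an isometry `W` from `(ℂ²)^{⊗ k}` onto the code space under
which every `k`-qubit Pauli operator is implemented by a logical Pauli operator of the code. -/
structure Encoding (C : StabilizerCode Q) (k : ℕ) where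
  W : Matrix (Q → Fin 2) (Fin k → Fin 2) ℂ
  isometry : Wᴴ * W = 1
  range_eq : LinearMap.range W.mulVecLin = C.codeSpace
  pauli : ∀ P ∈ pauliGroup (Fin k), ∃ P' ∈ C.logicalPaulis,
    (P' : QubitOp Q) * W = W * (P : QubitOp (Fin k))

/-- The physical unitary `U` implements the logical gate `L` on the `k` encoded qubits. As `W` is
an isometry, there is at most one such `L`. -/
def Encoding.Implements {C : StabilizerCode Q} {k : ℕ} (E : C.Encoding k)
    (U : QubitUnitary Q) (L : QubitUnitary (Fin k)) : Prop :=
  (U : QubitOp Q) * E.W = E.W * (L : QubitOp (Fin k))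

end StabilizerCode

/-! ## Assouad dimension of a family of metric spaces, intrinsic dimension of a code family -/

/-- The covering condition with exponent `α` for a family of spaces with distance functions `d i`:
with one constant `K` for all members, centres and scales `0 < r < R`, every ball of radius `R` is
covered by at most `K * (R / r) ^ α` balls of radius `r`. -/
def CoveringCondition {I : Type*} {X : I → Type*} (d : ∀ i, X i → X i → ℝ) (α : ℝ) : Prop :=
  ∃ K : ℝ, 0 < K ∧ ∀ (i : I) (x : X i) (r R : ℝ), 0 < r → r < R →
    ∃ F : Finset (X i), (F.card : ℝ) ≤ K * (R / r) ^ α ∧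
      ∀ y : X i, d i x y ≤ R → ∃ z ∈ F, d i z y ≤ r

/-- The Assouad dimension of a family of spaces (`∞` if no exponent is admissible). -/
def assouadDim {I : Type*} {X : I → Type*} (d : ∀ i, X i → X i → ℝ) : ℝ≥0∞ :=
  ⨅ (α : ℝ≥0) (_ : CoveringCondition d (α : ℝ)), (α : ℝ≥0∞)

/-- The intrinsic (locality) dimension of a family of stabilizer codes with specified generators:
the Assouad dimension of the family of connectivity graphs with their shortest-path metrics. -/
def intrinsicDim {I : Type*} {V : I → Type*} [∀ i, Fintype (V i)] [∀ i, DecidableEq (V i)]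
    (C : ∀ i, StabilizerCode (V i)) : ℝ≥0∞ :=
  assouadDim (fun i u v => ((C i).connectivityGraph.dist u v : ℝ))

/-! ## Graph-local gates and circuits -/

/-- A gate set (a set of unitaries for each member of the family) is graph-local if any two qubits
in the support of a gate are joined in the connectivity graph by a path of length at most `η`, with
`η` independent of the member of the family and of the gate. -/
def IsGraphLocal {I : Type*} {V : I → Type*} [∀ i, Fintype (V i)] [∀ i, DecidableEq (V i)]
    (C : ∀ i, StabilizerCode (V i)) (𝒢 : ∀ i, Set (QubitUnitary (V i))) : Prop :=
  ∃ η : ℕ, ∀ i, ∀ g ∈ 𝒢 i, ∀ u ∈ opSupport (g : QubitOp (V i)),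
    ∀ v ∈ opSupport (g : QubitOp (V i)),
      ∃ p : (C i).connectivityGraph.Walk u v, p.length ≤ η

/-- One circuit layer: a product of finitely many gates from `𝒢` with pairwise disjoint supports. -/
def IsLayer {Q : Type*} [Fintype Q] [DecidableEq Q] (𝒢 : Set (QubitUnitary Q))
    (U : QubitUnitary Q) : Prop :=
  ∃ l : List (QubitUnitary Q), (∀ g ∈ l, g ∈ 𝒢) ∧
    l.Pairwise (fun g g' => Disjoint (opSupport (g : QubitOp Q)) (opSupport (g' : QubitOp Q))) ∧
    U = l.prod

/-- `U` is realized by a circuit over the gate set `𝒢` with at most `h` layers. -/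
def HasDepthAtMost {Q : Type*} [Fintype Q] [DecidableEq Q] (𝒢 : Set (QubitUnitary Q)) (h : ℕ)
    (U : QubitUnitary Q) : Prop :=
  ∃ ls : List (QubitUnitary Q), ls.length ≤ h ∧ (∀ L ∈ ls, IsLayer 𝒢 L) ∧ U = ls.prod

end

/-!
A code family of dimension `β` has, with `n = ⌊β⌋`, a partition of the qubits into `n + 1` regions
which remain correctable after a bounded thickening, and codes with such a partition only admit
locality-preserving logical gates in level `n` of the Clifford hierarchy.

*Partition.* Let `α < n + 1` be an exponent for the covering condition. Around the points of a net
at scale `R` the radii of balls are chosen so that thin annuli at their boundaries contain few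
points; off the annuli, the balls cut the space into well separated cells of diameter `O(R)`, which
get one colour. Repeating this on the set of points in the annuli decreases its density by a factor
`O(1 / R)` each time, while a ball of radius `2 * R` has only `O(R ^ α)` points. So for large `R`
nothing is left after `n + 1` colours (`exists_uniform_colouring`). Cells have boundedly many
qubits, so they are correctable if the distance is large, and no generator meets two cells of the
same colour, so the colour classes are correctable (`correctable_of_cells`).

*Level of the gate.* An operator supported on a correctable region acts on the code space as a
scalar, by its Pauli expansion. By the cleaning lemma `exists_cleaned`, every logical Pauli operator
has a representative `P` which is trivial near a given colour class. For a locality-preserving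
unitary `U`, the commutator `U * P * U⁻¹ * P⁻¹` is then trivial on this class, and it is again
locality preserving and supported within the support of `U`. After `n` commutators only one colour
is left, so the logical action is a scalar; undoing the commutators one at a time, the logical
action of `U` is in level `n` of the hierarchy, up to a phase. For `n ≥ 2` the phase does not
matter, and for `n = 1` there is no code to consider: two correctable regions cannot cover the
qubits of a code which encodes a qubit.
-/

noncomputable section

/-! ### The Pauli operators as a projective representation of `𝔽₂²` on every qubit -/

/-- The label of the Pauli matrix with exponent vector `(a, b)`: it is `X ^ a * Z ^ b` up to a
phase. -/
def vecLabel (u : ZMod 2 × ZMod 2) : PauliLabel :=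
  if u.1 = 0 then (if u.2 = 0 then .I else .Z) else (if u.2 = 0 then .X else .Y)

/-- The exponent vector of a Pauli label. -/
def labelVec : PauliLabel → ZMod 2 × ZMod 2
  | .I => (0, 0)
  | .X => (1, 0)
  | .Y => (1, 1)
  | .Z => (0, 1)

lemma vecLabel_labelVec (l : PauliLabel) : vecLabel (labelVec l) = l := by
  cases l <;> simp [vecLabel, labelVec]

/-- The Hermitian single-qubit Pauli matrix with exponent vector `u`. -/
def sigma (u : ZMod 2 × ZMod 2) : Matrix (Fin 2) (Fin 2) ℂ := (vecLabel u).toMatrix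

/-- The Hermitian Pauli string with exponent vectors `v`. -/
def pauliOp {Q : Type*} [Fintype Q] (v : Q → ZMod 2 × ZMod 2) : QubitOp Q :=
  fun x y => ∏ q, sigma (v q) (x q) (y q)

/-- The standard symplectic form on `𝔽₂²`. -/
def sympl (u w : ZMod 2 × ZMod 2) : ZMod 2 := u.1 * w.2 + u.2 * w.1

/-- The standard symplectic form on `(𝔽₂²)^Q`. -/
def symplForm {Q : Type*} [Fintype Q] (v w : Q → ZMod 2 × ZMod 2) : ZMod 2 :=
  ∑ q, sympl (v q) (w q)

/-- The nontrivial character of `𝔽₂`. -/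
def sgn (a : ZMod 2) : ℂ := if a = 0 then 1 else -1

lemma zmod_two_cases (a : ZMod 2) : a = 0 ∨ a = 1 := by
  revert a; decide

lemma sgn_zero : sgn 0 = 1 := by simp [sgn]

lemma sgn_one : sgn 1 = -1 := by simp [sgn]

lemma sgn_add (a b : ZMod 2) : sgn (a + b) = sgn a * sgn b := by
  have h : (1 + 1 : ZMod 2) = 0 := by decide
  rcases zmod_two_cases a with rfl | rfl <;> rcases zmod_two_cases b with rfl | rfl <;>
    simp [sgn, h]

lemma sgn_sum {ι : Type*} (s : Finset ι) (f : ι → ZMod 2) :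
    sgn (∑ i ∈ s, f i) = ∏ i ∈ s, sgn (f i) := by
  classical
  induction s using Finset.induction_on with
  | empty => simp [sgn_zero]
  | insert a s ha ih => rw [Finset.sum_insert ha, Finset.prod_insert ha, sgn_add, ih]

lemma sgn_injective : Function.Injective sgn := by
  intro a b h
  rcases zmod_two_cases a with rfl | rfl <;> rcases zmod_two_cases b with rfl | rfl <;>
    simp [sgn] at h ⊢ <;> norm_num [Complex.ext_iff] at h

lemma sigma_zero : sigma 0 = 1 := by simp [sigma, vecLabel, PauliLabel.toMatrix]

lemma zmod_two_prod_cases (p : ZMod 2 × ZMod 2 → Prop) (h0 : p (0, 0)) (h1 : p (0, 1)) (h2 : p (1, 0))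
    (h3 : p (1, 1)) (u : ZMod 2 × ZMod 2) : p u := by
  obtain ⟨a, b⟩ := u
  rcases zmod_two_cases a with rfl | rfl <;> rcases zmod_two_cases b with rfl | rfl <;> assumption

lemma sigma_mul (u w : ZMod 2 × ZMod 2) :
    ∃ c ∈ ({1, -1, Complex.I, -Complex.I} : Set ℂ), sigma u * sigma w = c • sigma (u + w) := by
  have h : (1 + 1 : ZMod 2) = 0 := by decide
  revert u w
  refine zmod_two_prod_cases _ ?_ ?_ ?_ ?_ <;> refine zmod_two_prod_cases _ ?_ ?_ ?_ ?_ <;>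
    simp [sigma, vecLabel, PauliLabel.toMatrix, h, Matrix.one_fin_two]

lemma sigma_mul_comm (u w : ZMod 2 × ZMod 2) :
    sigma u * sigma w = sgn (sympl u w) • (sigma w * sigma u) := by
  have h : (1 + 1 : ZMod 2) = 0 := by decide
  revert u w
  refine zmod_two_prod_cases _ ?_ ?_ ?_ ?_ <;> refine zmod_two_prod_cases _ ?_ ?_ ?_ ?_ <;>
    simp [sigma, vecLabel, PauliLabel.toMatrix, sgn, sympl, h, Matrix.one_fin_two]

lemma sigma_mul_self (u : ZMod 2 × ZMod 2) : sigma u * sigma u = 1 := by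
  revert u
  refine zmod_two_prod_cases _ ?_ ?_ ?_ ?_ <;>
    simp [sigma, vecLabel, PauliLabel.toMatrix, Matrix.one_fin_two]

lemma star_sigma (u : ZMod 2 × ZMod 2) (a b : Fin 2) : star (sigma u a b) = sigma u b a := by
  revert u
  refine zmod_two_prod_cases _ ?_ ?_ ?_ ?_ <;> fin_cases a <;> fin_cases b <;>
    simp [sigma, vecLabel, PauliLabel.toMatrix]

/-- The completeness relation of the Pauli matrices. -/
lemma sum_sigma (a b c d : Fin 2) :
    ∑ u, sigma u a b * sigma u c d = if a = d ∧ b = c then 2 else 0 := by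
  have : (Finset.univ : Finset (ZMod 2 × ZMod 2)) = {(0, 0), (0, 1), (1, 0), (1, 1)} := by decide
  rw [this]
  fin_cases a <;> fin_cases b <;> fin_cases c <;> fin_cases d <;>
    simp [sigma, vecLabel, PauliLabel.toMatrix] <;> norm_num

section PauliOp

variable {Q : Type*} [Fintype Q]

lemma symplForm_comm (v w : Q → ZMod 2 × ZMod 2) : symplForm v w = symplForm w v := by
  refine Finset.sum_congr rfl fun q _ => ?_
  simp only [sympl]; ring

lemma symplForm_single [DecidableEq Q] (v : Q → ZMod 2 × ZMod 2) (q : Q) (u : ZMod 2 × ZMod 2) :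
    symplForm v (Pi.single q u) = sympl (v q) u := by
  rw [symplForm, Finset.sum_eq_single q]
  · simp
  · intro b _ hb; simp [hb, sympl]
  · simp

lemma exists_sympl_eq_one {u : ZMod 2 × ZMod 2} (hu : u ≠ 0) : ∃ w, sympl u w = 1 := by
  revert u; unfold sympl; decide

lemma eq_of_symplForm_eq [DecidableEq Q] {v w : Q → ZMod 2 × ZMod 2}
    (h : ∀ t, symplForm v t = symplForm w t) : v = w := by
  funext q
  have key : ∀ a b : ZMod 2 × ZMod 2, (∀ u, sympl a u = sympl b u) → a = b := by
    unfold sympl; decide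
  refine key _ _ fun u => ?_
  rw [← symplForm_single, ← symplForm_single, h]

lemma prod_mul_prod_apply [DecidableEq Q] (M N : Q → Matrix (Fin 2) (Fin 2) ℂ) (x y : Q → Fin 2) :
    ∑ z : Q → Fin 2, (∏ q, M q (x q) (z q)) * ∏ q, N q (z q) (y q) =
      ∏ q, (M q * N q) (x q) (y q) := by
  simp only [Matrix.mul_apply]
  rw [Finset.prod_univ_sum, Fintype.piFinset_univ]
  simp only [Finset.prod_mul_distrib]

lemma pauliOp_mul_apply [DecidableEq Q] (v w : Q → ZMod 2 × ZMod 2) (x y : Q → Fin 2) :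
    (pauliOp v * pauliOp w) x y = ∏ q, (sigma (v q) * sigma (w q)) (x q) (y q) := by
  rw [← prod_mul_prod_apply, Matrix.mul_apply]; rfl

lemma prod_one_apply [DecidableEq Q] (x y : Q → Fin 2) :
    ∏ q, (1 : Matrix (Fin 2) (Fin 2) ℂ) (x q) (y q) = (1 : QubitOp Q) x y := by
  simp only [Matrix.one_apply]
  by_cases h : x = y
  · simp [h]
  · rw [if_neg h]
    obtain ⟨q, hq⟩ := Function.ne_iff.1 h
    exact Finset.prod_eq_zero (Finset.mem_univ q) (if_neg hq)

lemma pauliOp_zero [DecidableEq Q] : pauliOp (0 : Q → ZMod 2 × ZMod 2) = 1 := by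
  ext x y
  simp only [pauliOp, Pi.zero_apply, sigma_zero, prod_one_apply]

lemma pauliOp_mul_self [DecidableEq Q] (v : Q → ZMod 2 × ZMod 2) : pauliOp v * pauliOp v = 1 := by
  ext x y
  simp only [pauliOp_mul_apply, sigma_mul_self, prod_one_apply]

lemma phase_mul {a b : ℂ} (ha : a ∈ ({1, -1, Complex.I, -Complex.I} : Set ℂ))
    (hb : b ∈ ({1, -1, Complex.I, -Complex.I} : Set ℂ)) :
    a * b ∈ ({1, -1, Complex.I, -Complex.I} : Set ℂ) := by
  simp only [Set.mem_insert_iff, Set.mem_singleton_iff] at *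
  rcases ha with rfl | rfl | rfl | rfl <;> rcases hb with rfl | rfl | rfl | rfl <;> simp

lemma pauliOp_mul [DecidableEq Q] (v w : Q → ZMod 2 × ZMod 2) :
    ∃ c ∈ ({1, -1, Complex.I, -Complex.I} : Set ℂ),
      pauliOp v * pauliOp w = c • pauliOp (v + w) := by
  choose c hc h using fun q => sigma_mul (v q) (w q)
  refine ⟨∏ q, c q, ?_, ?_⟩
  · exact Finset.prod_induction c (· ∈ ({1, -1, Complex.I, -Complex.I} : Set ℂ))
      (fun a b => phase_mul) (by simp) (fun q _ => hc q)
  · ext x y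
    rw [pauliOp_mul_apply, Matrix.smul_apply, smul_eq_mul, pauliOp, ← Finset.prod_mul_distrib]
    exact Finset.prod_congr rfl fun q _ => by rw [h]; rfl

lemma pauliOp_mul_comm [DecidableEq Q] (v w : Q → ZMod 2 × ZMod 2) :
    pauliOp v * pauliOp w = sgn (symplForm v w) • (pauliOp w * pauliOp v) := by
  ext x y
  rw [Matrix.smul_apply, pauliOp_mul_apply, pauliOp_mul_apply, symplForm, sgn_sum, smul_eq_mul,
    ← Finset.prod_mul_distrib]
  exact Finset.prod_congr rfl fun q _ => by rw [sigma_mul_comm]; rfl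

lemma conjTranspose_pauliOp (v : Q → ZMod 2 × ZMod 2) : (pauliOp v)ᴴ = pauliOp v := by
  ext x y
  rw [Matrix.conjTranspose_apply, pauliOp, pauliOp, star_prod]
  exact Finset.prod_congr rfl fun q _ => star_sigma _ _ _

lemma pauliOp_mem_unitaryGroup [DecidableEq Q] (v : Q → ZMod 2 × ZMod 2) :
    pauliOp v ∈ Matrix.unitaryGroup (Q → Fin 2) ℂ := by
  rw [Matrix.mem_unitaryGroup_iff, Matrix.star_eq_conjTranspose, conjTranspose_pauliOp,
    pauliOp_mul_self]

/-- The Pauli string with exponent vectors `v` as a unitary. -/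
def pauliUnitary [DecidableEq Q] (v : Q → ZMod 2 × ZMod 2) : QubitUnitary Q :=
  ⟨pauliOp v, pauliOp_mem_unitaryGroup v⟩

lemma mem_pauliGroup_iff [DecidableEq Q] {U : QubitUnitary Q} :
    U ∈ pauliGroup Q ↔ ∃ c ∈ ({1, -1, Complex.I, -Complex.I} : Set ℂ),
      ∃ v : Q → ZMod 2 × ZMod 2, (U : QubitOp Q) = c • pauliOp v := by
  constructor
  · rintro ⟨c, hc, p, h⟩
    refine ⟨c, hc, fun q => labelVec (p q), h.trans (congrArg (c • ·) ?_)⟩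
    ext x y
    exact Finset.prod_congr rfl fun q _ => by rw [sigma, vecLabel_labelVec]
  · rintro ⟨c, hc, v, h⟩
    exact ⟨c, hc, fun q => vecLabel (v q), h⟩

lemma pauliUnitary_mem [DecidableEq Q] (v : Q → ZMod 2 × ZMod 2) :
    pauliUnitary v ∈ pauliGroup Q :=
  mem_pauliGroup_iff.2 ⟨1, by simp, v, by simp [pauliUnitary]⟩

lemma mul_mem_pauliGroup [DecidableEq Q] {U T : QubitUnitary Q} (hU : U ∈ pauliGroup Q)
    (hT : T ∈ pauliGroup Q) : U * T ∈ pauliGroup Q := by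
  obtain ⟨c, hc, v, hv⟩ := mem_pauliGroup_iff.1 hU
  obtain ⟨d, hd, w, hw⟩ := mem_pauliGroup_iff.1 hT
  obtain ⟨e, he, h⟩ := pauliOp_mul v w
  refine mem_pauliGroup_iff.2 ⟨c * d * e, phase_mul (phase_mul hc hd) he, v + w, ?_⟩
  rw [Submonoid.coe_mul, hv, hw, smul_mul_smul_comm, h, smul_smul]

lemma coe_inv_unitary [DecidableEq Q] (U : QubitUnitary Q) :
    ((U⁻¹ : QubitUnitary Q) : QubitOp Q) = (U : QubitOp Q)ᴴ :=
  rfl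

lemma inv_mem_pauliGroup [DecidableEq Q] {U : QubitUnitary Q} (hU : U ∈ pauliGroup Q) :
    U⁻¹ ∈ pauliGroup Q := by
  obtain ⟨c, hc, v, hv⟩ := mem_pauliGroup_iff.1 hU
  refine mem_pauliGroup_iff.2 ⟨star c, ?_, v, ?_⟩
  · simp only [Set.mem_insert_iff, Set.mem_singleton_iff] at *
    rcases hc with rfl | rfl | rfl | rfl <;> simp
  · rw [coe_inv_unitary, hv, Matrix.conjTranspose_smul, conjTranspose_pauliOp]

lemma coe_unitary_ne_zero [DecidableEq Q] (U : QubitUnitary Q) : (U : QubitOp Q) ≠ 0 := by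
  intro h
  have h2 : ((U⁻¹ * U : QubitUnitary Q) : QubitOp Q) = 1 := by rw [inv_mul_cancel]; rfl
  rw [Submonoid.coe_mul, h, mul_zero] at h2
  exact zero_ne_one h2

/-! ### Pauli expansion of an operator -/

/-- The coefficient of the Pauli string `v` in the Pauli expansion of `A`. -/
def pauliCoeff [DecidableEq Q] (A : QubitOp Q) (v : Q → ZMod 2 × ZMod 2) : ℂ :=
  (2 ^ Fintype.card Q)⁻¹ * (A * pauliOp v).trace

lemma sum_pauliOp [DecidableEq Q] (x y z w : Q → Fin 2) :
    ∑ v : Q → ZMod 2 × ZMod 2, pauliOp v x y * pauliOp v z w =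
      if x = w ∧ y = z then 2 ^ Fintype.card Q else 0 := by
  have h1 : ∑ v : Q → ZMod 2 × ZMod 2, pauliOp v x y * pauliOp v z w =
      ∏ q, ∑ u, sigma u (x q) (y q) * sigma u (z q) (w q) := by
    rw [Finset.prod_univ_sum, Fintype.piFinset_univ]
    simp only [pauliOp, Finset.prod_mul_distrib]
  rw [h1]
  simp only [sum_sigma]
  split_ifs with h
  · obtain ⟨rfl, rfl⟩ := h
    simp
  · have h' : (∃ q, x q ≠ w q) ∨ ∃ q, y q ≠ z q := by
      rwa [← Function.ne_iff, ← Function.ne_iff, ← not_and_or]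
    rcases h' with ⟨q, hq⟩ | ⟨q, hq⟩
    · exact Finset.prod_eq_zero (Finset.mem_univ q) (if_neg fun h => hq h.1)
    · exact Finset.prod_eq_zero (Finset.mem_univ q) (if_neg fun h => hq h.2)

lemma sum_pauliCoeff [DecidableEq Q] (A : QubitOp Q) :
    ∑ v, pauliCoeff A v • pauliOp v = A := by
  ext x y
  have h2 : (2 ^ Fintype.card Q : ℂ) ≠ 0 := pow_ne_zero _ two_ne_zero
  calc (∑ v, pauliCoeff A v • pauliOp v) x y
      = ∑ v, (2 ^ Fintype.card Q)⁻¹ * ∑ z, ∑ w, A z w * (pauliOp v x y * pauliOp v w z) := by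
        rw [Matrix.sum_apply]
        refine Finset.sum_congr rfl fun v _ => ?_
        rw [Matrix.smul_apply, pauliCoeff, smul_eq_mul, mul_assoc, Matrix.trace]
        simp only [Matrix.diag_apply, Matrix.mul_apply, Finset.sum_mul]
        congr 1
        exact Finset.sum_congr rfl fun z _ => Finset.sum_congr rfl fun w _ => by ring
    _ = (2 ^ Fintype.card Q)⁻¹ * ∑ z, ∑ w, A z w * ∑ v, pauliOp v x y * pauliOp v w z := by
        rw [← Finset.mul_sum, Finset.sum_comm]
        congr 1
        refine Finset.sum_congr rfl fun z _ => ?_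
        rw [Finset.sum_comm]
        exact Finset.sum_congr rfl fun w _ => by rw [Finset.mul_sum]
    _ = A x y := by
        simp only [sum_pauliOp]
        rw [Finset.sum_eq_single x, Finset.sum_eq_single y]
        · simp [mul_comm, h2]
        · intro b _ hb; simp [hb.symm]
        · simp
        · intro b _ hb; simp [hb.symm]
        · simp

lemma trace_pauliOp [DecidableEq Q] {v : Q → ZMod 2 × ZMod 2} (hv : v ≠ 0) :
    (pauliOp v).trace = 0 := by
  obtain ⟨q, hq⟩ := Function.ne_iff.1 hv
  obtain ⟨u, hu⟩ := exists_sympl_eq_one hq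
  -- Conjugation by an anticommuting Pauli string flips the sign of the trace.
  have h1 : (pauliOp v).trace = (pauliOp v * pauliOp (Pi.single q u) *
      pauliOp (Pi.single q u)).trace := by rw [mul_assoc, pauliOp_mul_self, mul_one]
  rw [pauliOp_mul_comm, symplForm_single, hu, sgn_one, neg_one_smul, neg_mul, Matrix.trace_neg,
    Matrix.trace_mul_comm, ← mul_assoc, pauliOp_mul_self, one_mul] at h1
  linear_combination h1 / 2

lemma pauliCoeff_pauliOp [DecidableEq Q] (v w : Q → ZMod 2 × ZMod 2) :
    pauliCoeff (pauliOp v) w = if v = w then 1 else 0 := by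
  split_ifs with h
  · subst h
    rw [pauliCoeff, pauliOp_mul_self, Matrix.trace_one]
    simp
  · obtain ⟨c, -, hc⟩ := pauliOp_mul v w
    have hne : v + w ≠ 0 := by
      intro h0
      apply h
      rw [eq_neg_of_add_eq_zero_left h0]
      funext q
      have : ∀ a : ZMod 2 × ZMod 2, -a = a := by decide
      exact this _
    rw [pauliCoeff, hc, Matrix.trace_smul, trace_pauliOp hne]
    simp

lemma pauliCoeff_smul [DecidableEq Q] (c : ℂ) (A : QubitOp Q) (v : Q → ZMod 2 × ZMod 2) :
    pauliCoeff (c • A) v = c * pauliCoeff A v := by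
  rw [pauliCoeff, pauliCoeff, smul_mul_assoc, Matrix.trace_smul, smul_eq_mul]; ring

lemma pauliOp_ne_zero [DecidableEq Q] (v : Q → ZMod 2 × ZMod 2) : pauliOp v ≠ 0 := by
  intro h
  have := pauliOp_mul_self v
  rw [h, mul_zero] at this
  exact zero_ne_one this

lemma pauliOp_injective_smul [DecidableEq Q] {v w : Q → ZMod 2 × ZMod 2} {c d : ℂ} (hc : c ≠ 0)
    (h : c • pauliOp v = d • pauliOp w) : v = w := by
  by_contra hne
  have := congrArg (fun A => pauliCoeff A v) h
  simp only [pauliCoeff_smul, pauliCoeff_pauliOp, if_true, if_neg (Ne.symm hne)] at this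
  simp [hc] at this

/-- An operator which commutes with every Pauli string up to a scalar is a multiple of a Pauli
string: all Pauli strings in its expansion have the same commutation signs. -/
lemma eq_smul_pauliOp_of_commute [DecidableEq Q] {A : QubitOp Q}
    (hA : ∀ w, ∃ c : ℂ, A * pauliOp w = c • (pauliOp w * A)) :
    ∃ (c : ℂ) (v : Q → ZMod 2 × ZMod 2), A = c • pauliOp v := by
  have hcoeff : ∀ w (c : ℂ), A * pauliOp w = c • (pauliOp w * A) → ∀ v, pauliCoeff A v ≠ 0 →
      sgn (symplForm v w) = c := by
    intro w c h v hv
    have h2 : (A * pauliOp w * (pauliOp w * pauliOp v)).trace =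
        c * (pauliOp w * A * (pauliOp w * pauliOp v)).trace := by
      rw [h, smul_mul_assoc, Matrix.trace_smul, smul_eq_mul]
    have h3 : A * pauliOp w * (pauliOp w * pauliOp v) = A * pauliOp v := by
      rw [mul_assoc, ← mul_assoc (pauliOp w), pauliOp_mul_self, one_mul]
    have h4 : (pauliOp w * A * (pauliOp w * pauliOp v)).trace =
        sgn (symplForm w v) * (A * pauliOp v).trace := by
      rw [mul_assoc, Matrix.trace_mul_comm, pauliOp_mul_comm w v, mul_smul_comm, smul_mul_assoc,
        Matrix.trace_smul, smul_eq_mul, mul_assoc, mul_assoc, pauliOp_mul_self, mul_one]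
    have h5 : sgn (symplForm w v) * sgn (symplForm w v) = 1 := by
      rw [← sgn_add, CharTwo.add_self_eq_zero, sgn_zero]
    have h6 : (A * pauliOp v).trace ≠ 0 := fun h0 => hv (by rw [pauliCoeff, h0, mul_zero])
    rw [h3, h4] at h2
    have h7 : c * sgn (symplForm w v) = 1 := by
      apply mul_right_cancel₀ h6
      rw [one_mul, mul_assoc, ← h2]
    rw [symplForm_comm]
    linear_combination c * h5 - sgn (symplForm w v) * h7
  by_cases h0 : ∀ v, pauliCoeff A v = 0
  · exact ⟨0, 0, by rw [← sum_pauliCoeff A]; simp [h0]⟩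
  · push Not at h0
    obtain ⟨v, hv⟩ := h0
    refine ⟨pauliCoeff A v, v, ?_⟩
    conv_lhs => rw [← sum_pauliCoeff A]
    refine Finset.sum_eq_single v (fun w _ hw => ?_) (by simp)
    suffices pauliCoeff A w = 0 by rw [this, zero_smul]
    by_contra hw0
    refine hw (eq_of_symplForm_eq fun t => sgn_injective ?_)
    obtain ⟨c, hc⟩ := hA t
    rw [hcoeff t c hc w hw0, hcoeff t c hc v hv]

end PauliOp

/-! ### Supports of operators -/

section Support

variable {Q : Type*} [Fintype Q] [DecidableEq Q]

lemma pauliOp_single_apply (q : Q) (u : ZMod 2 × ZMod 2) (x y : Q → Fin 2) :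
    pauliOp (Pi.single q u) x y =
      if ∀ q' ≠ q, x q' = y q' then sigma u (x q) (y q) else 0 := by
  rw [pauliOp]
  split_ifs with h
  · rw [Finset.prod_eq_single q]
    · simp
    · intro b _ hb
      rw [Pi.single_eq_of_ne hb, sigma_zero, h b hb, Matrix.one_apply_eq]
    · simp
  · push Not at h
    obtain ⟨b, hb, hxy⟩ := h
    refine Finset.prod_eq_zero (Finset.mem_univ b) ?_
    rw [Pi.single_eq_of_ne hb, sigma_zero, Matrix.one_apply_ne hxy]

lemma ActsTriviallyOn.commute_pauliOp {A : QubitOp Q} {q : Q} (hA : ActsTriviallyOn A q)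
    (u : ZMod 2 × ZMod 2) : Commute A (pauliOp (Pi.single q u)) := by
  -- Both products have the entry `sigma u (x q) (y q) * A (x with x q = 0) (y with y q = 0)`.
  ext x y
  rw [Matrix.mul_apply, Matrix.mul_apply, Finset.sum_eq_single (Function.update y q (x q)),
    Finset.sum_eq_single (Function.update x q (y q)), hA x, hA _ y]
  · rw [pauliOp_single_apply, pauliOp_single_apply, if_pos, if_pos, if_pos, if_pos]
    · simp [mul_comm]
    · simp
    · intro q' h; simp [h]
    · intro q' h; simp [h]
    · simp
  · intro z _ hz
    by_cases h : ∀ q' ≠ q, x q' = z q'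
    · have : z q ≠ y q := by
        intro hzy
        apply hz
        funext q'
        by_cases hq : q' = q
        · subst hq; simp [hzy]
        · simp [hq, h q' hq]
      rw [hA z, if_neg this, mul_zero]
    · rw [pauliOp_single_apply, if_neg h, zero_mul]
  · simp
  · intro z _ hz
    by_cases h : ∀ q' ≠ q, z q' = y q'
    · have : x q ≠ z q := by
        intro hzy
        apply hz
        funext q'
        by_cases hq : q' = q
        · subst hq; simp [hzy]
        · simp [hq, h q' hq]
      rw [hA x, if_neg this, zero_mul]
    · rw [pauliOp_single_apply, if_neg h, mul_zero]
  · simp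

lemma pauliCoeff_eq_zero_of_commute {A : QubitOp Q} {q : Q}
    (hA : ∀ u, Commute A (pauliOp (Pi.single q u))) {v : Q → ZMod 2 × ZMod 2} (hv : v q ≠ 0) :
    pauliCoeff A v = 0 := by
  obtain ⟨u, hu⟩ := exists_sympl_eq_one hv
  have h1 : (A * pauliOp v).trace = -(A * pauliOp v).trace := by
    calc (A * pauliOp v).trace
        = (A * (pauliOp v * pauliOp (Pi.single q u)) * pauliOp (Pi.single q u)).trace := by
          rw [mul_assoc, mul_assoc, pauliOp_mul_self, mul_one]
      _ = -(pauliOp (Pi.single q u) * (A * (pauliOp (Pi.single q u) * pauliOp v))).trace := by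
          rw [pauliOp_mul_comm, symplForm_single, hu, sgn_one, neg_one_smul, mul_neg, neg_mul,
            Matrix.trace_neg, Matrix.trace_mul_comm]
      _ = -(A * pauliOp v).trace := by
          rw [← mul_assoc, ← (hA u).eq, mul_assoc, ← mul_assoc (pauliOp _), pauliOp_mul_self,
            one_mul]
  rw [pauliCoeff, self_eq_neg.1 h1, mul_zero]

lemma actsTriviallyOn_pauliOp {v : Q → ZMod 2 × ZMod 2} {q : Q} (hv : v q = 0) :
    ActsTriviallyOn (pauliOp v) q := by
  intro x y
  rw [pauliOp, pauliOp, ← Finset.mul_prod_erase _ _ (Finset.mem_univ q),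
    ← Finset.mul_prod_erase _ _ (Finset.mem_univ q)]
  simp only [hv, sigma_zero, Function.update_self, Matrix.one_apply_eq, one_mul]
  split_ifs with h
  · rw [h, Matrix.one_apply_eq, one_mul]
    refine Finset.prod_congr rfl fun q' hq' => ?_
    have := Finset.ne_of_mem_erase hq'
    simp [this]
  · rw [Matrix.one_apply_ne h, zero_mul]

lemma actsTriviallyOn_of_pauliCoeff {A : QubitOp Q} {q : Q}
    (hA : ∀ v : Q → ZMod 2 × ZMod 2, v q ≠ 0 → pauliCoeff A v = 0) : ActsTriviallyOn A q := by
  intro x y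
  rw [← sum_pauliCoeff A]
  simp only [Matrix.sum_apply, Matrix.smul_apply, smul_eq_mul]
  have : ∀ v : Q → ZMod 2 × ZMod 2, pauliCoeff A v * pauliOp v x y = if x q = y q then
      pauliCoeff A v * pauliOp v (Function.update x q 0) (Function.update y q 0) else 0 := by
    intro v
    by_cases hv : v q = 0
    · rw [actsTriviallyOn_pauliOp hv x y]
      split_ifs <;> simp
    · simp [hA v hv]
  rw [Finset.sum_congr rfl fun v _ => this v]
  split_ifs <;> simp

/-- An operator acts trivially on a qubit iff it commutes with the Pauli operators of that qubit. -/
lemma notMem_opSupport_iff {A : QubitOp Q} {q : Q} :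
    q ∉ opSupport A ↔ ∀ u, Commute A (pauliOp (Pi.single q u)) := by
  rw [opSupport, Set.mem_ofPred_eq, not_not]
  exact ⟨fun h => h.commute_pauliOp, fun h =>
    actsTriviallyOn_of_pauliCoeff fun v hv => pauliCoeff_eq_zero_of_commute h hv⟩

lemma pauliCoeff_eq_zero {A : QubitOp Q} {v : Q → ZMod 2 × ZMod 2} {q : Q}
    (hq : q ∉ opSupport A) (hv : v q ≠ 0) : pauliCoeff A v = 0 :=
  pauliCoeff_eq_zero_of_commute (notMem_opSupport_iff.1 hq) hv

lemma opSupport_mul_subset (A B : QubitOp Q) : opSupport (A * B) ⊆ opSupport A ∪ opSupport B := by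
  intro q hq
  by_contra h
  rw [Set.mem_union, not_or] at h
  exact notMem_opSupport_iff.2 (fun u => (notMem_opSupport_iff.1 h.1 u).mul_left
    (notMem_opSupport_iff.1 h.2 u)) hq

lemma opSupport_conjTranspose (A : QubitOp Q) : opSupport Aᴴ = opSupport A := by
  have key : ∀ B : QubitOp Q, opSupport Bᴴ ⊆ opSupport B := by
    intro B q hq
    by_contra h
    refine notMem_opSupport_iff.2 (fun u => ?_) hq
    have := congrArg Matrix.conjTranspose (notMem_opSupport_iff.1 h u).eq
    rw [Matrix.conjTranspose_mul, Matrix.conjTranspose_mul, conjTranspose_pauliOp] at this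
    exact this.symm
  refine Set.Subset.antisymm (key A) ?_
  simpa using key Aᴴ

lemma opSupport_inv (U : QubitUnitary Q) :
    opSupport ((U⁻¹ : QubitUnitary Q) : QubitOp Q) = opSupport (U : QubitOp Q) := by
  rw [coe_inv_unitary, opSupport_conjTranspose]

lemma opSupport_smul_pauliOp {c : ℂ} (hc : c ≠ 0) (v : Q → ZMod 2 × ZMod 2) :
    opSupport (c • pauliOp v) = {q | v q ≠ 0} := by
  ext q
  constructor
  · intro h hv
    refine notMem_opSupport_iff.2 (fun u => ?_) h
    exact ((actsTriviallyOn_pauliOp hv).commute_pauliOp u).smul_left c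
  · intro hv
    by_contra h
    have := pauliCoeff_eq_zero h hv
    rw [pauliCoeff_smul, pauliCoeff_pauliOp, if_pos rfl, mul_one] at this
    exact hc this

/-- Operators with disjoint supports commute, because the Pauli strings in their expansions do. -/
lemma commute_of_disjoint_opSupport {A B : QubitOp Q} (h : Disjoint (opSupport A) (opSupport B)) :
    Commute A B := by
  rw [← sum_pauliCoeff A, ← sum_pauliCoeff B]
  refine Commute.sum_left _ _ _ fun v _ => Commute.sum_right _ _ _ fun w _ => ?_
  by_cases hv : pauliCoeff A v = 0
  · simp [hv]
  by_cases hw : pauliCoeff B w = 0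
  · simp [hw]
  refine (Commute.smul_left ?_ _).smul_right _
  have h0 : symplForm v w = 0 := by
    refine Finset.sum_eq_zero fun q _ => ?_
    by_cases hvq : v q = 0
    · simp [sympl, hvq]
    by_cases hwq : w q = 0
    · simp [sympl, hwq]
    have h1 : q ∈ opSupport A := by
      by_contra h; exact hv (pauliCoeff_eq_zero h hvq)
    have h2 : q ∈ opSupport B := by
      by_contra h; exact hw (pauliCoeff_eq_zero h hwq)
    exact (Set.disjoint_left.1 h h1 h2).elim
  rw [Commute, SemiconjBy, pauliOp_mul_comm, h0, sgn_zero, one_smul]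

lemma conj_eq_self_of_commute {U : QubitUnitary Q} {O : QubitOp Q}
    (h : Commute (U : QubitOp Q) O) :
    (U : QubitOp Q) * O * ((U⁻¹ : QubitUnitary Q) : QubitOp Q) = O := by
  rw [h.eq, mul_assoc, ← Submonoid.coe_mul, mul_inv_cancel]
  simp

/-- Conjugation by a Pauli operator does not enlarge supports. -/
lemma opSupport_conj_pauli_subset {P : QubitUnitary Q} (hP : P ∈ pauliGroup Q) (O : QubitOp Q) :
    opSupport ((P : QubitOp Q) * O * ((P⁻¹ : QubitUnitary Q) : QubitOp Q)) ⊆ opSupport O := by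
  obtain ⟨c, hc, v, hv⟩ := mem_pauliGroup_iff.1 hP
  intro q hq
  by_contra h
  refine notMem_opSupport_iff.2 (fun u => ?_) hq
  have hO := notMem_opSupport_iff.1 h u
  -- The Pauli operator commutes with the single-qubit one up to a sign, which cancels.
  have h1 : (P : QubitOp Q) * pauliOp (Pi.single q u) =
      sgn (symplForm v (Pi.single q u)) • (pauliOp (Pi.single q u) * (P : QubitOp Q)) := by
    rw [hv, smul_mul_assoc, pauliOp_mul_comm, mul_smul_comm, smul_comm]
  have h2 : ((P⁻¹ : QubitUnitary Q) : QubitOp Q) * pauliOp (Pi.single q u) =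
      sgn (symplForm v (Pi.single q u)) •
        (pauliOp (Pi.single q u) * ((P⁻¹ : QubitUnitary Q) : QubitOp Q)) := by
    rw [coe_inv_unitary, hv, Matrix.conjTranspose_smul, conjTranspose_pauliOp, smul_mul_assoc,
      pauliOp_mul_comm, mul_smul_comm, smul_comm]
  have h3 : sgn (symplForm v (Pi.single q u)) * sgn (symplForm v (Pi.single q u)) = 1 := by
    rw [← sgn_add, CharTwo.add_self_eq_zero, sgn_zero]
  rw [Commute, SemiconjBy, mul_assoc, h2, mul_smul_comm, ← mul_assoc, mul_assoc (P : QubitOp Q),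
    hO.eq, ← mul_assoc, h1, smul_mul_assoc, smul_mul_assoc, smul_smul, h3, one_smul]
  simp only [mul_assoc]

end Support

/-! ### Correctable regions of a stabilizer code -/

namespace StabilizerCode

variable {Q : Type*} [Fintype Q] [DecidableEq Q] (C : StabilizerCode Q)

/-- The stabilizer group modulo phases, as a subspace of `(𝔽₂²)^Q`. -/
def stabSpace : Submodule (ZMod 2) (Q → ZMod 2 × ZMod 2) :=
  AddSubgroup.toZModSubmodule 2
    { carrier := {v | ∃ s ∈ C.stabilizer, ∃ c : ℂ, (s : QubitOp Q) = c • pauliOp v}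
      zero_mem' := ⟨1, one_mem _, 1, by rw [pauliOp_zero, one_smul]; rfl⟩
      add_mem' := by
        rintro v w ⟨s, hs, c, hc⟩ ⟨t, ht, d, hd⟩
        obtain ⟨e, -, he⟩ := pauliOp_mul v w
        refine ⟨s * t, mul_mem hs ht, c * d * e, ?_⟩
        rw [Submonoid.coe_mul, hc, hd, smul_mul_smul_comm, he, smul_smul]
      neg_mem' := by
        rintro v ⟨s, hs, c, hc⟩
        refine ⟨s, hs, c, ?_⟩
        rwa [show -v = v from funext fun q => (by decide : ∀ a : ZMod 2 × ZMod 2, -a = a) _] }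

lemma mem_stabSpace {v : Q → ZMod 2 × ZMod 2} :
    v ∈ C.stabSpace ↔ ∃ s ∈ C.stabilizer, ∃ c : ℂ, (s : QubitOp Q) = c • pauliOp v := Iff.rfl

/-- A set of qubits is correctable if every logical Pauli operator supported on it is a stabilizer
up to a phase. -/
def Correctable (A : Set Q) : Prop :=
  ∀ v : Q → ZMod 2 × ZMod 2, (∀ q ∉ A, v q = 0) → (∀ w ∈ C.stabSpace, symplForm v w = 0) →
    v ∈ C.stabSpace

variable {C}

lemma symplForm_eq_zero_of_commute {U T : QubitUnitary Q} {v w : Q → ZMod 2 × ZMod 2} {c d : ℂ}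
    (hU : (U : QubitOp Q) = c • pauliOp v) (hT : (T : QubitOp Q) = d • pauliOp w)
    (h : U * T = T * U) : symplForm v w = 0 := by
  have h1 : (U : QubitOp Q) * T = T * U := congrArg Subtype.val h
  have hne : (T : QubitOp Q) * U ≠ 0 := coe_unitary_ne_zero (T * U)
  have h4 : (U : QubitOp Q) * T = sgn (symplForm v w) • ((T : QubitOp Q) * U) := by
    rw [hU, hT, smul_mul_smul_comm, smul_mul_smul_comm, pauliOp_mul_comm, smul_comm, mul_comm c]
  rw [h1] at h4
  by_contra hs
  rcases zmod_two_cases (symplForm v w) with h0 | h0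
  · exact hs h0
  · rw [h0, sgn_one, neg_one_smul] at h4
    have h5 : (2 : ℂ) • ((T : QubitOp Q) * U) = 0 := by
      rw [two_smul]
      nth_rewrite 1 [h4]
      exact neg_add_cancel _
    exact hne ((smul_eq_zero.1 h5).resolve_left two_ne_zero)

lemma commute_of_symplForm_eq_zero {U T : QubitUnitary Q} {v w : Q → ZMod 2 × ZMod 2} {c d : ℂ}
    (hU : (U : QubitOp Q) = c • pauliOp v) (hT : (T : QubitOp Q) = d • pauliOp w)
    (h : symplForm v w = 0) : U * T = T * U := by
  apply Subtype.ext
  rw [Submonoid.coe_mul, Submonoid.coe_mul, hU, hT, smul_mul_smul_comm, smul_mul_smul_comm,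
    pauliOp_mul_comm, h, sgn_zero, one_smul, mul_comm c]

lemma smul_coeff_ne_zero {U : QubitUnitary Q} {v : Q → ZMod 2 × ZMod 2} {c : ℂ}
    (hU : (U : QubitOp Q) = c • pauliOp v) : c ≠ 0 := by
  rintro rfl
  exact coe_unitary_ne_zero U (by rw [hU, zero_smul])

lemma commute_stabilizer_of_commute_gens {U : QubitUnitary Q}
    (h : ∀ s ∈ C.gens, U * s = s * U) {s : QubitUnitary Q} (hs : s ∈ C.stabilizer) :
    U * s = s * U := by
  induction hs using Subgroup.closure_induction with
  | mem s hs => exact h s hs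
  | one => simp
  | mul x y _ _ hx hy => rw [← mul_assoc, hx, mul_assoc, hy, mul_assoc]
  | inv x _ hx => exact (Commute.inv_right (show Commute U x from hx)).eq

lemma stabilizer_subset_pauliGroup {s : QubitUnitary Q} (hs : s ∈ C.stabilizer) :
    s ∈ pauliGroup Q := by
  induction hs using Subgroup.closure_induction with
  | mem s hs => exact C.gens_pauli hs
  | one => exact mem_pauliGroup_iff.2 ⟨1, by simp, 0, by rw [pauliOp_zero, one_smul]; rfl⟩
  | mul x y _ _ hx hy => exact mul_mem_pauliGroup hx hy
  | inv x _ hx => exact inv_mem_pauliGroup hx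

lemma symplForm_eq_zero_of_mem_logicalPaulis {P : QubitUnitary Q} (hP : P ∈ C.logicalPaulis)
    {v : Q → ZMod 2 × ZMod 2} {c : ℂ} (hv : (P : QubitOp Q) = c • pauliOp v)
    {w : Q → ZMod 2 × ZMod 2} (hw : w ∈ C.stabSpace) : symplForm v w = 0 := by
  obtain ⟨s, hs, d, hd⟩ := C.mem_stabSpace.1 hw
  exact symplForm_eq_zero_of_commute hv hd (commute_stabilizer_of_commute_gens hP.2 hs)

lemma exists_gens_eq {s : QubitUnitary Q} (hs : s ∈ C.gens) :
    ∃ c : ℂ, ∃ v ∈ C.stabSpace, (s : QubitOp Q) = c • pauliOp v := by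
  obtain ⟨c, -, v, hv⟩ := mem_pauliGroup_iff.1 (C.gens_pauli hs)
  exact ⟨c, v, ⟨s, Subgroup.subset_closure hs, c, hv⟩, hv⟩

lemma pauliUnitary_mem_logicalPaulis {v : Q → ZMod 2 × ZMod 2}
    (h : ∀ w ∈ C.stabSpace, symplForm v w = 0) : pauliUnitary v ∈ C.logicalPaulis := by
  refine ⟨pauliUnitary_mem v, fun s hs => ?_⟩
  obtain ⟨c, w, hw, hc⟩ := exists_gens_eq hs
  exact commute_of_symplForm_eq_zero (c := 1) (by simp [pauliUnitary]) hc (h w hw)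

lemma symplForm_stabSpace_eq_zero_of_gens {v : Q → ZMod 2 × ZMod 2}
    (h : ∀ s ∈ C.gens, ∀ (c : ℂ) (w : Q → ZMod 2 × ZMod 2), (s : QubitOp Q) = c • pauliOp w →
      symplForm v w = 0) : ∀ w ∈ C.stabSpace, symplForm v w = 0 := by
  intro w hw
  refine symplForm_eq_zero_of_mem_logicalPaulis (P := pauliUnitary v) (c := 1)
    ⟨pauliUnitary_mem v, fun s hs => ?_⟩ (by simp [pauliUnitary]) hw
  obtain ⟨c, w', -, hc⟩ := exists_gens_eq hs
  exact commute_of_symplForm_eq_zero (c := 1) (by simp [pauliUnitary]) hc (h s hs c w' hc)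

/-- Regions with fewer qubits than the code distance are correctable. -/
lemma correctable_of_ncard_lt {A : Set Q} (hA : A.ncard < C.distance) : C.Correctable A := by
  intro v hvA hv
  by_contra hcon
  have hmem : pauliUnitary v ∈ C.nontrivialLogicalPaulis := by
    refine ⟨pauliUnitary_mem_logicalPaulis hv, ?_⟩
    rintro ⟨c, s, hs, hc⟩
    have hc0 : c ≠ 0 := by
      rintro rfl
      rw [zero_smul] at hc
      exact pauliOp_ne_zero v hc
    refine hcon ⟨s, hs, c⁻¹, ?_⟩
    rw [show pauliOp v = c • (s : QubitOp Q) from hc, inv_smul_smul₀ hc0]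
  have h1 : C.distance ≤ (opSupport (pauliUnitary v : QubitOp Q)).ncard :=
    Nat.sInf_le ⟨_, hmem, rfl⟩
  have h2 : opSupport (pauliUnitary v : QubitOp Q) ⊆ A := by
    have : (pauliUnitary v : QubitOp Q) = (1 : ℂ) • pauliOp v := by simp [pauliUnitary]
    rw [this, opSupport_smul_pauliOp one_ne_zero]
    intro q hq
    by_contra h
    exact hq (hvA q h)
  have h3 := Set.ncard_le_ncard h2 (Set.toFinite A)
  omega

/-- A region is correctable if it is partitioned into correctable cells such that no generator
acts on two of them: the restriction of a logical Pauli operator to a cell is again logical. -/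
lemma correctable_of_cells {ι : Type*} {A : Set Q} (f : Q → ι)
    (hadj : ∀ u ∈ A, ∀ v ∈ A, C.connectivityGraph.Adj u v → f u = f v)
    (hcell : ∀ c, C.Correctable {q | q ∈ A ∧ f q = c}) : C.Correctable A := by
  classical
  intro v hvA hv
  let cell : ι → Q → ZMod 2 × ZMod 2 := fun c q => if f q = c then v q else 0
  have hsum : v = ∑ c ∈ Finset.univ.image f, cell c := by
    funext q
    rw [Finset.sum_apply, Finset.sum_eq_single (f q)]
    · simp [cell]
    · intro c _ hc
      simp [cell, hc.symm]
    · simp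
  rw [hsum]
  refine Submodule.sum_mem _ fun c _ => hcell c _ ?_ ?_
  · intro q hq
    by_cases hfq : f q = c
    · simp only [cell, hfq, if_true]
      exact hvA q fun hqA => hq ⟨hqA, hfq⟩
    · simp [cell, hfq]
  · refine symplForm_stabSpace_eq_zero_of_gens fun s hs d w hw => ?_
    have hsupp : ∀ q, w q ≠ 0 → q ∈ opSupport (s : QubitOp Q) := by
      intro q hq
      rw [hw, opSupport_smul_pauliOp (smul_coeff_ne_zero hw)]
      exact hq
    have hvw : symplForm v w = 0 := hv w ⟨s, Subgroup.subset_closure hs, d, hw⟩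
    by_cases hex : ∃ q₀, cell c q₀ ≠ 0 ∧ w q₀ ≠ 0
    · -- The generator meets this cell, so it meets no other cell.
      obtain ⟨q₀, hq₀, hw₀⟩ := hex
      have hfq₀ : f q₀ = c := by
        by_contra h; exact hq₀ (by simp [cell, h])
      have hq₀A : q₀ ∈ A := by
        by_contra h
        apply hq₀
        simp only [cell, hvA q₀ h, ite_self]
      rw [← hvw]
      refine Finset.sum_congr rfl fun q _ => ?_
      by_cases hwq : w q = 0
      · simp [sympl, hwq]
      by_cases hvq : v q = 0
      · simp [cell, hvq]
      have hqA : q ∈ A := by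
        by_contra h; exact hvq (hvA q h)
      have hfq : f q = c := by
        by_cases hqq : q = q₀
        · rw [hqq, hfq₀]
        · rw [← hfq₀]
          exact hadj q hqA q₀ hq₀A ⟨hqq, s, hs, hsupp q hwq, hsupp q₀ hw₀⟩
      simp [cell, hfq]
    · push Not at hex
      refine Finset.sum_eq_zero fun q _ => ?_
      by_cases hcq : cell c q = 0
      · simp [sympl, hcq]
      · simp [sympl, hex q hcq]

/-- Every linear functional on `(𝔽₂²)^Q` is a pairing with a vector under the symplectic form. -/
lemma exists_symplForm_eq (g : (Q → ZMod 2 × ZMod 2) →ₗ[ZMod 2] ZMod 2) :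
    ∃ t : Q → ZMod 2 × ZMod 2, (∀ w, g w = symplForm t w) ∧
      ∀ q, (∀ u, g (Pi.single q u) = 0) → t q = 0 := by
  refine ⟨fun q => (g (Pi.single q (0, 1)), g (Pi.single q (1, 0))), fun w => ?_, fun q hq => by
    simp [hq]⟩
  have hw : w = ∑ q, ((w q).1 • (Pi.single q (1, 0) : Q → ZMod 2 × ZMod 2) +
      (w q).2 • (Pi.single q (0, 1) : Q → ZMod 2 × ZMod 2)) := by
    funext q
    rw [Finset.sum_apply, Finset.sum_eq_single q]
    · simp
    · intro b _ hb
      simp [hb.symm]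
    · simp
  conv_lhs => rw [hw]
  rw [map_sum]
  refine Finset.sum_congr rfl fun q _ => ?_
  rw [map_add, map_smul, map_smul, sympl, smul_eq_mul, smul_eq_mul]
  ring

/-- The cleaning lemma: a logical Pauli operator can be multiplied by a stabilizer so that it acts
trivially on a given correctable region `A`. Otherwise some linear functional separates its
restriction to `A` from those of the stabilizers; it is the pairing with a Pauli operator on `A`
which commutes with all stabilizers but not with the given logical operator. -/
lemma exists_cleaned {A : Set Q} (hA : C.Correctable A) {P : QubitUnitary Q}
    (hP : P ∈ C.logicalPaulis) :
    ∃ s ∈ C.stabilizer, P * s ∈ C.logicalPaulis ∧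
      Disjoint (opSupport ((P * s : QubitUnitary Q) : QubitOp Q)) A := by
  classical
  obtain ⟨c, hc, v, hv⟩ := mem_pauliGroup_iff.1 hP.1
  let ρ : (Q → ZMod 2 × ZMod 2) →ₗ[ZMod 2] (Q → ZMod 2 × ZMod 2) :=
    { toFun := fun w q => if q ∈ A then w q else 0
      map_add' := fun w w' => by funext q; by_cases h : q ∈ A <;> simp [h]
      map_smul' := fun a w => by funext q; by_cases h : q ∈ A <;> simp [h] }
  have hρ : ∀ w q, ρ w q = if q ∈ A then w q else 0 := fun _ _ => rfl
  have hmem : ρ v ∈ C.stabSpace.map ρ := by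
    by_contra hcon
    obtain ⟨g, hg, hg0⟩ := Submodule.exists_dual_map_eq_bot_of_notMem hcon inferInstance
    obtain ⟨t, ht, htA⟩ := exists_symplForm_eq (g ∘ₗ ρ)
    have htS : t ∈ C.stabSpace := by
      refine hA t (fun q hq => htA q fun u => ?_) fun w hw => ?_
      · have : ρ (Pi.single q u) = 0 := by
          funext q'
          rw [hρ]
          by_cases h : q' ∈ A
          · rw [if_pos h, Pi.single_eq_of_ne (by rintro rfl; exact hq h)]; rfl
          · rw [if_neg h]; rfl
        rw [LinearMap.comp_apply, this, map_zero]
      · rw [← ht, LinearMap.comp_apply]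
        have : g (ρ w) ∈ (C.stabSpace.map ρ).map g :=
          Submodule.mem_map_of_mem (Submodule.mem_map_of_mem hw)
        rwa [hg0, Submodule.mem_bot] at this
    apply hg
    have := symplForm_eq_zero_of_mem_logicalPaulis hP hv htS
    rwa [symplForm_comm, ← ht, LinearMap.comp_apply] at this
  obtain ⟨w, ⟨s, hs, d, hd⟩, hw⟩ := hmem
  obtain ⟨e, -, he⟩ := pauliOp_mul v w
  have hPs : ((P * s : QubitUnitary Q) : QubitOp Q) = (c * d * e) • pauliOp (v + w) := by
    rw [Submonoid.coe_mul, hv, hd, smul_mul_smul_comm, he, smul_smul]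
  refine ⟨s, hs, ⟨?_, fun r hr => ?_⟩, ?_⟩
  · have hsP : s ∈ pauliGroup Q := stabilizer_subset_pauliGroup hs
    exact mul_mem_pauliGroup hP.1 hsP
  · have h1 : s * r = r * s := by
      refine (commute_stabilizer_of_commute_gens (U := r) (fun t ht => ?_) hs).symm
      exact C.gens_commute r hr t ht
    rw [mul_assoc, h1, ← mul_assoc, hP.2 r hr, mul_assoc]
  · rw [hPs, opSupport_smul_pauliOp (smul_coeff_ne_zero hPs), Set.disjoint_left]
    intro q hq hqA
    apply hq
    have := congrFun hw q
    rw [hρ, hρ, if_pos hqA, if_pos hqA] at this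
    rw [Pi.add_apply, this]
    exact (by decide : ∀ a : ZMod 2 × ZMod 2, a + a = 0) _

end StabilizerCode

/-! ### Locality-preserving unitaries -/

section Spread

variable {Q : Type*}

/-- The `r`-neighbourhood of a set of vertices of a graph. -/
def thick (G : SimpleGraph Q) (r : ℕ) (S : Set Q) : Set Q :=
  {v | ∃ u ∈ S, G.dist u v ≤ r}

lemma subset_thick (G : SimpleGraph Q) (r : ℕ) (S : Set Q) : S ⊆ thick G r S :=
  fun v hv => ⟨v, hv, by simp⟩

lemma thick_mono {G : SimpleGraph Q} {r r' : ℕ} (hr : r ≤ r') {S T : Set Q} (h : S ⊆ T) :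
    thick G r S ⊆ thick G r' T :=
  fun _ ⟨u, hu, hd⟩ => ⟨u, h hu, hd.trans hr⟩

lemma thick_thick_subset {G : SimpleGraph Q} (hG : G.Connected) (r r' : ℕ) (S : Set Q) :
    thick G r (thick G r' S) ⊆ thick G (r + r') S := by
  rintro v ⟨u, ⟨w, hw, hwu⟩, huv⟩
  refine ⟨w, hw, ?_⟩
  have := hG.dist_triangle (u := w) (v := u) (w := v)
  omega

variable [Fintype Q] [DecidableEq Q]

/-- Conjugation by the unitary `U` enlarges the support of an operator by distance at most `r`. -/
def Spread (G : SimpleGraph Q) (r : ℕ) (U : QubitUnitary Q) : Prop :=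
  ∀ O : QubitOp Q,
    opSupport ((U : QubitOp Q) * O * ((U⁻¹ : QubitUnitary Q) : QubitOp Q)) ⊆
      thick G r (opSupport O)

lemma Spread.mono {G : SimpleGraph Q} {r r' : ℕ} {U : QubitUnitary Q} (h : Spread G r U)
    (hr : r ≤ r') : Spread G r' U :=
  fun O => (h O).trans (thick_mono hr subset_rfl)

lemma coe_conj_mul (U T : QubitUnitary Q) (O : QubitOp Q) :
    ((U * T : QubitUnitary Q) : QubitOp Q) * O * (((U * T)⁻¹ : QubitUnitary Q) : QubitOp Q) =
      (U : QubitOp Q) * ((T : QubitOp Q) * O * ((T⁻¹ : QubitUnitary Q) : QubitOp Q)) *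
        ((U⁻¹ : QubitUnitary Q) : QubitOp Q) := by
  rw [mul_inv_rev, Submonoid.coe_mul, Submonoid.coe_mul]
  simp only [mul_assoc]

lemma coe_inv_mul_coe (U : QubitUnitary Q) :
    ((U⁻¹ : QubitUnitary Q) : QubitOp Q) * (U : QubitOp Q) = 1 := by
  rw [← Submonoid.coe_mul, inv_mul_cancel]; rfl

lemma Spread.mul {G : SimpleGraph Q} (hG : G.Connected) {r r' : ℕ} {U T : QubitUnitary Q}
    (hU : Spread G r U) (hT : Spread G r' T) : Spread G (r + r') (U * T) := by
  intro O
  rw [coe_conj_mul]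
  exact ((hU _).trans (thick_mono le_rfl (hT O))).trans (thick_thick_subset hG r r' _)

lemma commute_conj {M : Type*} [Monoid M] {a b s o : M} (h : b * a = 1)
    (hc : Commute (a * s * b) o) : Commute (b * o * a) s :=
  calc b * o * a * s = b * (o * (a * s * b)) * a := by simp only [mul_assoc, h, mul_one]
    _ = b * (a * s * b * o) * a := by rw [hc.eq]
    _ = b * a * s * (b * o * a) := by simp only [mul_assoc]
    _ = s * (b * o * a) := by rw [h, one_mul]

/-- If `U` spreads supports by at most `r`, so does `U⁻¹`: the operator `U⁻¹ * O * U` commutes with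
a single-qubit operator `S` iff `O` commutes with `U * S * U⁻¹`. -/
lemma Spread.inv {G : SimpleGraph Q} {r : ℕ} {U : QubitUnitary Q} (hU : Spread G r U) :
    Spread G r U⁻¹ := by
  intro O q hq
  by_contra hcon
  refine notMem_opSupport_iff.2 (fun u => ?_) hq
  rw [inv_inv]
  refine commute_conj (coe_inv_mul_coe U) (commute_of_disjoint_opSupport ?_)
  rw [Set.disjoint_left]
  intro x hx hxO
  obtain ⟨y, hy, hyx⟩ := hU _ hx
  have hyq : y = q := by
    by_contra hne
    rw [← one_smul ℂ (pauliOp _), opSupport_smul_pauliOp one_ne_zero] at hy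
    exact hy (Pi.single_eq_of_ne hne _)
  subst hyq
  exact hcon ⟨x, hxO, by rwa [SimpleGraph.dist_comm]⟩

lemma spread_of_mem_pauliGroup (G : SimpleGraph Q) {P : QubitUnitary Q} (hP : P ∈ pauliGroup Q) :
    Spread G 0 P :=
  fun O => (opSupport_conj_pauli_subset hP O).trans (subset_thick G 0 _)

lemma spread_one (G : SimpleGraph Q) : Spread G 0 (1 : QubitUnitary Q) := by
  intro O
  rw [inv_one, Submonoid.coe_one, one_mul, mul_one]
  exact subset_thick G 0 _

/-- Conjugation by a product of gates with disjoint supports adds to the support of an operator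
only the supports of the gates which meet it. -/
lemma opSupport_conj_layer (O : QubitOp Q) (l : List (QubitUnitary Q))
    (hl : l.Pairwise fun g g' : QubitUnitary Q =>
      Disjoint (opSupport (g : QubitOp Q)) (opSupport (g' : QubitOp Q))) :
    opSupport ((l.prod : QubitOp Q) * O * ((l.prod⁻¹ : QubitUnitary Q) : QubitOp Q)) ⊆
      opSupport O ∪ {q | ∃ g ∈ l, q ∈ opSupport (g : QubitOp Q) ∧
        ¬ Disjoint (opSupport (g : QubitOp Q)) (opSupport O)} := by
  induction l with
  | nil => simp
  | cons g l ih =>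
    obtain ⟨hg, hl⟩ := List.pairwise_cons.1 hl
    have ih := ih hl
    rw [List.prod_cons, coe_conj_mul]
    set O' := (l.prod : QubitOp Q) * O * ((l.prod⁻¹ : QubitUnitary Q) : QubitOp Q)
    have hsub : opSupport O' ⊆ opSupport O ∪ {q | ∃ g' ∈ g :: l, q ∈ opSupport (g' : QubitOp Q) ∧
        ¬ Disjoint (opSupport (g' : QubitOp Q)) (opSupport O)} := by
      refine ih.trans (Set.union_subset_union_right _ ?_)
      rintro q ⟨g', hg', h⟩
      exact ⟨g', List.mem_cons_of_mem _ hg', h⟩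
    by_cases hd : Disjoint (opSupport (g : QubitOp Q)) (opSupport O)
    · have hd' : Disjoint (opSupport (g : QubitOp Q)) (opSupport O') := by
        rw [Set.disjoint_left]
        intro q hq hqO
        rcases ih hqO with h | ⟨g', hg', h, -⟩
        · exact Set.disjoint_left.1 hd hq h
        · exact Set.disjoint_left.1 (hg g' hg') hq h
      rw [conj_eq_self_of_commute (commute_of_disjoint_opSupport hd')]
      exact hsub
    · have hgsub : opSupport (g : QubitOp Q) ⊆ opSupport O ∪ {q | ∃ g' ∈ g :: l,
          q ∈ opSupport (g' : QubitOp Q) ∧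
            ¬ Disjoint (opSupport (g' : QubitOp Q)) (opSupport O)} :=
        fun q hq => Or.inr ⟨g, List.mem_cons_self, hq, hd⟩
      refine (opSupport_mul_subset _ _).trans (Set.union_subset
        ((opSupport_mul_subset _ _).trans (Set.union_subset hgsub hsub)) ?_)
      rw [opSupport_inv]
      exact hgsub

lemma IsLayer.spread {G : SimpleGraph Q} {𝒢 : Set (QubitUnitary Q)} {η : ℕ}
    (h𝒢 : ∀ g ∈ 𝒢, ∀ u ∈ opSupport (g : QubitOp Q), ∀ v ∈ opSupport (g : QubitOp Q),
      ∃ p : G.Walk u v, p.length ≤ η) {U : QubitUnitary Q} (hU : IsLayer 𝒢 U) : Spread G η U := by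
  obtain ⟨l, hl, hpair, rfl⟩ := hU
  -- The disjointness condition is a statement about the list of the matrices of the gates.
  have hpair' : l.Pairwise fun g g' : QubitUnitary Q =>
      Disjoint (opSupport (g : QubitOp Q)) (opSupport (g' : QubitOp Q)) := by
    rw [← List.pairwise_map (f := fun g : QubitUnitary Q => (g : QubitOp Q))
      (R := fun A B => Disjoint (opSupport A) (opSupport B))]
    simpa [List.map_eq_flatMap] using hpair
  intro O
  refine (opSupport_conj_layer O l hpair').trans (Set.union_subset (subset_thick G η _) ?_)
  rintro q ⟨g, hg, hq, hd⟩
  obtain ⟨u, hu, huO⟩ := Set.not_disjoint_iff.1 hd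
  obtain ⟨p, hp⟩ := h𝒢 g (hl g hg) u hu q hq
  exact ⟨u, huO, (SimpleGraph.dist_le p).trans hp⟩

lemma HasDepthAtMost.spread {G : SimpleGraph Q} (hG : G.Connected) {𝒢 : Set (QubitUnitary Q)}
    {η : ℕ} (h𝒢 : ∀ g ∈ 𝒢, ∀ u ∈ opSupport (g : QubitOp Q), ∀ v ∈ opSupport (g : QubitOp Q),
      ∃ p : G.Walk u v, p.length ≤ η) {h : ℕ} {U : QubitUnitary Q} (hU : HasDepthAtMost 𝒢 h U) :
    Spread G (h * η) U := by
  obtain ⟨ls, hlen, hls, rfl⟩ := hU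
  have key : ∀ l : List (QubitUnitary Q), (∀ L ∈ l, IsLayer 𝒢 L) →
      Spread G (l.length * η) l.prod := by
    intro l
    induction l with
    | nil => intro _; simpa using spread_one G
    | cons L l ih =>
      intro hl
      have := ((hl L List.mem_cons_self).spread h𝒢).mul hG
        (ih fun L' hL' => hl L' (List.mem_cons_of_mem _ hL'))
      rw [List.prod_cons, List.length_cons]
      exact this.mono (by rw [Nat.succ_mul, add_comm])
  exact (key ls hls).mono (Nat.mul_le_mul_right _ hlen)

end Spread

/-! ### Logical action of operators on an encoding -/

namespace StabilizerCode

variable {Q : Type*} [Fintype Q] [DecidableEq Q] {C : StabilizerCode Q} {k : ℕ}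

lemma Correctable.mono {A B : Set Q} (hB : C.Correctable B) (h : A ⊆ B) : C.Correctable A :=
  fun v hv hw => hB v (fun q hq => hv q fun hqA => hq (h hqA)) hw

namespace Encoding

lemma matrix_eq_of_mulVec {m n : Type*} [Fintype n] [DecidableEq n] {M N : Matrix m n ℂ}
    (h : ∀ φ, M *ᵥ φ = N *ᵥ φ) : M = N :=
  Matrix.toLin'.injective (LinearMap.ext fun φ => by
    rw [Matrix.toLin'_apply, Matrix.toLin'_apply, h])

lemma mulVec_mem (E : C.Encoding k) (φ : (Fin k → Fin 2) → ℂ) : E.W *ᵥ φ ∈ C.codeSpace := by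
  rw [← E.range_eq]
  exact ⟨φ, rfl⟩

lemma stabilizer_mul (E : C.Encoding k) {s : QubitUnitary Q} (hs : s ∈ C.stabilizer) :
    (s : QubitOp Q) * E.W = E.W :=
  matrix_eq_of_mulVec fun φ => by
    rw [← Matrix.mulVec_mulVec]
    exact E.mulVec_mem φ s hs

lemma conjTranspose_mul_stabilizer (E : C.Encoding k) {s : QubitUnitary Q}
    (hs : s ∈ C.stabilizer) : E.Wᴴ * (s : QubitOp Q) = E.Wᴴ := by
  have := congrArg Matrix.conjTranspose (E.stabilizer_mul (inv_mem hs))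
  rwa [Matrix.conjTranspose_mul, coe_inv_unitary, Matrix.conjTranspose_conjTranspose] at this

/-- A logical gate implements some unitary on the encoded qubits. -/
lemma exists_implements (E : C.Encoding k) {U : QubitUnitary Q} (hU : C.IsLogicalGate U) :
    ∃ L, E.Implements U L := by
  have hproj : E.W * (E.Wᴴ * (U : QubitOp Q) * E.W) = (U : QubitOp Q) * E.W := by
    refine matrix_eq_of_mulVec fun φ => ?_
    have hmem : (U : QubitOp Q) *ᵥ (E.W *ᵥ φ) ∈ LinearMap.range E.W.mulVecLin := by
      rw [E.range_eq, ← hU]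
      exact Submodule.mem_map_of_mem (E.mulVec_mem φ)
    obtain ⟨ψ, hψ⟩ := hmem
    rw [Matrix.mulVecLin_apply] at hψ
    have h1 : E.Wᴴ *ᵥ (E.W *ᵥ ψ) = ψ := by
      rw [Matrix.mulVec_mulVec, E.isometry, Matrix.one_mulVec]
    rw [← Matrix.mulVec_mulVec, ← Matrix.mulVec_mulVec, ← Matrix.mulVec_mulVec, ← hψ, h1, hψ,
      Matrix.mulVec_mulVec]
  refine ⟨⟨E.Wᴴ * (U : QubitOp Q) * E.W, ?_⟩, hproj.symm⟩
  rw [Matrix.mem_unitaryGroup_iff', Matrix.star_eq_conjTranspose]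
  calc (E.Wᴴ * (U : QubitOp Q) * E.W)ᴴ * (E.Wᴴ * (U : QubitOp Q) * E.W)
      = E.Wᴴ * (U : QubitOp Q)ᴴ * (E.W * (E.Wᴴ * (U : QubitOp Q) * E.W)) := by
        simp only [Matrix.conjTranspose_mul, Matrix.conjTranspose_conjTranspose, Matrix.mul_assoc]
    _ = E.Wᴴ * ((U : QubitOp Q)ᴴ * (U : QubitOp Q)) * E.W := by
        rw [hproj]; simp only [Matrix.mul_assoc]
    _ = 1 := by
        rw [← coe_inv_unitary, coe_inv_mul_coe, Matrix.mul_one, E.isometry]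

variable {E : C.Encoding k}

lemma Implements.mul {U U' : QubitUnitary Q} {L L' : QubitUnitary (Fin k)}
    (h : E.Implements U L) (h' : E.Implements U' L') : E.Implements (U * U') (L * L') := by
  have h1 : (U : QubitOp Q) * E.W = E.W * (L : QubitOp (Fin k)) := h
  have h2 : (U' : QubitOp Q) * E.W = E.W * (L' : QubitOp (Fin k)) := h'
  change ((U * U' : QubitUnitary Q) : QubitOp Q) * E.W =
    E.W * ((L * L' : QubitUnitary (Fin k)) : QubitOp (Fin k))
  rw [Submonoid.coe_mul, Submonoid.coe_mul, Matrix.mul_assoc, h2, ← Matrix.mul_assoc, h1,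
    Matrix.mul_assoc]

lemma Implements.inv {U : QubitUnitary Q} {L : QubitUnitary (Fin k)} (h : E.Implements U L) :
    E.Implements U⁻¹ L⁻¹ := by
  have h1 : (U : QubitOp Q) * E.W = E.W * (L : QubitOp (Fin k)) := h
  have h2 : (L : QubitOp (Fin k)) * ((L⁻¹ : QubitUnitary (Fin k)) : QubitOp (Fin k)) = 1 := by
    simp
  change ((U⁻¹ : QubitUnitary Q) : QubitOp Q) * E.W =
    E.W * ((L⁻¹ : QubitUnitary (Fin k)) : QubitOp (Fin k))
  calc _ = ((U⁻¹ : QubitUnitary Q) : QubitOp Q) * (E.W * ((L : QubitOp (Fin k)) *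
        ((L⁻¹ : QubitUnitary (Fin k)) : QubitOp (Fin k)))) := by rw [h2, Matrix.mul_one]
    _ = ((U⁻¹ : QubitUnitary Q) : QubitOp Q) * (U : QubitOp Q) * (E.W *
        ((L⁻¹ : QubitUnitary (Fin k)) : QubitOp (Fin k))) := by
      rw [← Matrix.mul_assoc E.W, ← h1]; simp only [Matrix.mul_assoc]
    _ = _ := by rw [coe_inv_mul_coe, Matrix.one_mul]

/-- A Pauli string supported on a correctable region compresses to a scalar on the code space: it
either agrees with a stabilizer up to a phase or anticommutes with a stabilizer. -/
lemma exists_compression_pauliOp (E : C.Encoding k) {A : Set Q} (hA : C.Correctable A)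
    {v : Q → ZMod 2 × ZMod 2} (hv : ∀ q ∉ A, v q = 0) :
    ∃ c : ℂ, E.Wᴴ * pauliOp v * E.W = c • (1 : QubitOp (Fin k)) := by
  by_cases hw : ∀ w ∈ C.stabSpace, symplForm v w = 0
  · obtain ⟨s, hs, d, hd⟩ := hA v hv hw
    refine ⟨d⁻¹, ?_⟩
    have : pauliOp v = d⁻¹ • (s : QubitOp Q) := by
      rw [hd, inv_smul_smul₀ (smul_coeff_ne_zero hd)]
    rw [this, Matrix.mul_smul, Matrix.smul_mul, Matrix.mul_assoc, E.stabilizer_mul hs, E.isometry]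
  · push Not at hw
    obtain ⟨w, ⟨s, hs, d, hd⟩, hvw⟩ := hw
    have hvw1 : symplForm v w = 1 := (zmod_two_cases _).resolve_left hvw
    have hanti : pauliOp v * (s : QubitOp Q) = -((s : QubitOp Q) * pauliOp v) := by
      rw [hd, mul_smul_comm, pauliOp_mul_comm, hvw1, sgn_one, neg_one_smul, smul_mul_assoc,
        smul_neg]
    have h1 : E.Wᴴ * pauliOp v * E.W = -(E.Wᴴ * pauliOp v * E.W) :=
      calc E.Wᴴ * pauliOp v * E.W = E.Wᴴ * (pauliOp v * (s : QubitOp Q)) * E.W := by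
            rw [Matrix.mul_assoc, Matrix.mul_assoc, Matrix.mul_assoc, E.stabilizer_mul hs]
        _ = -(E.Wᴴ * (s : QubitOp Q) * pauliOp v * E.W) := by
            rw [hanti, Matrix.mul_neg, Matrix.neg_mul]; simp only [Matrix.mul_assoc]
        _ = _ := by rw [E.conjTranspose_mul_stabilizer hs]
    refine ⟨0, ?_⟩
    rw [zero_smul]
    have h2 : (2 : ℂ) • (E.Wᴴ * pauliOp v * E.W) = 0 := by
      rw [two_smul]
      nth_rewrite 1 [h1]
      exact neg_add_cancel _
    exact (smul_eq_zero.1 h2).resolve_left two_ne_zero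

/-- An operator supported on a correctable region acts as a scalar on the code space, if it
preserves it. -/
lemma Implements.exists_eq_smul_one {A : Set Q} (hA : C.Correctable A) {O : QubitUnitary Q}
    {L : QubitUnitary (Fin k)} (hO : opSupport (O : QubitOp Q) ⊆ A) (h : E.Implements O L) :
    ∃ c : ℂ, (L : QubitOp (Fin k)) = c • 1 := by
  have h1 : (L : QubitOp (Fin k)) = ∑ v, pauliCoeff (O : QubitOp Q) v •
      (E.Wᴴ * pauliOp v * E.W) := by
    have h2 : (O : QubitOp Q) * E.W = E.W * (L : QubitOp (Fin k)) := h
    calc (L : QubitOp (Fin k)) = E.Wᴴ * (O : QubitOp Q) * E.W := by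
          rw [Matrix.mul_assoc, h2, ← Matrix.mul_assoc, E.isometry, Matrix.one_mul]
      _ = E.Wᴴ * (∑ v, pauliCoeff (O : QubitOp Q) v • pauliOp v) * E.W := by rw [sum_pauliCoeff]
      _ = _ := by
          rw [Matrix.mul_sum, Matrix.sum_mul]
          simp only [Matrix.mul_smul, Matrix.smul_mul]
  have h3 : ∀ v, ∃ c : ℂ, pauliCoeff (O : QubitOp Q) v • (E.Wᴴ * pauliOp v * E.W) =
      c • (1 : QubitOp (Fin k)) := by
    intro v
    by_cases hv : ∀ q ∉ A, v q = 0
    · obtain ⟨c, hc⟩ := E.exists_compression_pauliOp hA hv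
      exact ⟨pauliCoeff (O : QubitOp Q) v * c, by rw [hc, smul_smul]⟩
    · push Not at hv
      obtain ⟨q, hq, hvq⟩ := hv
      refine ⟨0, ?_⟩
      rw [pauliCoeff_eq_zero (fun hqO => hq (hO hqO)) hvq, zero_smul, zero_smul]
  choose c hc using h3
  exact ⟨∑ v, c v, by rw [h1, Finset.sum_smul]; exact Finset.sum_congr rfl fun v _ => hc v⟩

/-- Every Pauli operator on the encoded qubits is implemented by a physical Pauli operator which
acts trivially on a given correctable region. -/
lemma exists_pauli_disjoint (E : C.Encoding k) {A : Set Q} (hA : C.Correctable A)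
    {P : QubitUnitary (Fin k)} (hP : P ∈ pauliGroup (Fin k)) :
    ∃ P' ∈ pauliGroup Q, E.Implements P' P ∧ Disjoint (opSupport (P' : QubitOp Q)) A := by
  obtain ⟨P₀, hP₀, himp⟩ := E.pauli P hP
  obtain ⟨s, hs, hlog, hdisj⟩ := exists_cleaned hA hP₀
  refine ⟨P₀ * s, hlog.1, ?_, hdisj⟩
  change ((P₀ * s : QubitUnitary Q) : QubitOp Q) * E.W = E.W * (P : QubitOp (Fin k))
  rw [Submonoid.coe_mul, Matrix.mul_assoc, E.stabilizer_mul hs, himp]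

/-- Taking the group commutator with a Pauli operator cleaned off a neighbourhood of `A` removes `A`
from the support of an operator, and at most doubles its spread. -/
lemma Implements.exists_commutator (hG : C.connectivityGraph.Connected) {A B : Set Q} {r r' : ℕ}
    (hr : r' ≤ r) (hA : C.Correctable (thick C.connectivityGraph r A)) {O : QubitUnitary Q}
    {L : QubitUnitary (Fin k)} (hsp : Spread C.connectivityGraph r' O) (himp : E.Implements O L)
    (hsupp : opSupport (O : QubitOp Q) ⊆ B ∪ A) {P : QubitUnitary (Fin k)}
    (hP : P ∈ pauliGroup (Fin k)) :
    ∃ O', Spread C.connectivityGraph (2 * r') O' ∧ E.Implements O' (L * P * L⁻¹ * P⁻¹) ∧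
      opSupport (O' : QubitOp Q) ⊆ B := by
  obtain ⟨P', hP', hPimp, hdisj⟩ := E.exists_pauli_disjoint hA hP
  refine ⟨O * P' * O⁻¹ * P'⁻¹, ?_, ((himp.mul hPimp).mul himp.inv).mul hPimp.inv, ?_⟩
  · exact ((((hsp.mul hG (spread_of_mem_pauliGroup _ hP')).mul hG hsp.inv).mul hG
      (spread_of_mem_pauliGroup _ (inv_mem_pauliGroup hP'))).mono (by omega))
  · intro q hq
    have hqO : q ∈ opSupport (O : QubitOp Q) := by
      have h1 : ((O * P' * O⁻¹ * P'⁻¹ : QubitUnitary Q) : QubitOp Q) = (O : QubitOp Q) *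
          ((P' : QubitOp Q) * ((O⁻¹ : QubitUnitary Q) : QubitOp Q) *
            ((P'⁻¹ : QubitUnitary Q) : QubitOp Q)) := by
        simp only [Submonoid.coe_mul, mul_assoc]
      rw [h1] at hq
      rcases opSupport_mul_subset _ _ hq with h | h
      · exact h
      · have := opSupport_conj_pauli_subset hP' _ h
        rwa [opSupport_inv] at this
    refine (hsupp hqO).resolve_right fun hqA => ?_
    rw [Submonoid.coe_mul] at hq
    rcases opSupport_mul_subset _ _ hq with h | h
    · rw [Submonoid.coe_mul, Submonoid.coe_mul] at h
      obtain ⟨x, hx, hxq⟩ := hsp _ h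
      exact Set.disjoint_left.1 hdisj hx
        ⟨q, hqA, by rw [SimpleGraph.dist_comm]; exact hxq.trans hr⟩
    · rw [opSupport_inv] at h
      exact Set.disjoint_left.1 hdisj h (subset_thick _ _ _ hqA)

end Encoding

end StabilizerCode

/-! ### Commutators and the Clifford hierarchy -/

section Hierarchy

variable {K : Type*} [Fintype K] [DecidableEq K]

lemma mul_mem_cliffordHierarchy {ℓ : ℕ} {U P : QubitUnitary K} (hU : U ∈ cliffordHierarchy K ℓ)
    (hP : P ∈ pauliGroup K) : U * P ∈ cliffordHierarchy K ℓ := by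
  match ℓ with
  | 0 => exact hU
  | 1 => exact mul_mem_pauliGroup hU hP
  | ℓ + 2 =>
    intro R hR
    have h : U * P * R * (U * P)⁻¹ = U * (P * R * P⁻¹) * U⁻¹ := by group
    rw [h]
    exact hU _ (mul_mem_pauliGroup (mul_mem_pauliGroup hP hR) (inv_mem_pauliGroup hP))

lemma mem_cliffordHierarchy_succ {ℓ : ℕ} (hℓ : 1 ≤ ℓ) {L : QubitUnitary K}
    (h : ∀ P ∈ pauliGroup K, L * P * L⁻¹ * P⁻¹ ∈ cliffordHierarchy K ℓ) :
    L ∈ cliffordHierarchy K (ℓ + 1) := by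
  obtain ⟨m, rfl⟩ := Nat.exists_eq_add_of_le' hℓ
  intro P hP
  have := mul_mem_cliffordHierarchy (h P hP) hP
  rwa [inv_mul_cancel_right] at this

lemma exists_eq_smul_pauliOp_of_commutator {L : QubitUnitary K}
    (h : ∀ P ∈ pauliGroup K, ∃ c : ℂ,
      ((L * P * L⁻¹ * P⁻¹ : QubitUnitary K) : QubitOp K) = c • 1) :
    ∃ (c : ℂ) (v : K → ZMod 2 × ZMod 2), (L : QubitOp K) = c • pauliOp v := by
  refine eq_smul_pauliOp_of_commute fun w => ?_
  obtain ⟨c, hc⟩ := h _ (pauliUnitary_mem w)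
  refine ⟨c, ?_⟩
  have h1 : L * pauliUnitary w = L * pauliUnitary w * L⁻¹ * (pauliUnitary w)⁻¹ *
      (pauliUnitary w * L) := by group
  have h2 := congrArg (Subtype.val) h1
  rw [Submonoid.coe_mul, Submonoid.coe_mul _ _ (pauliUnitary w * L), hc, smul_mul_assoc,
    one_mul, Submonoid.coe_mul] at h2
  exact h2

/-- If all commutators of `L` with Pauli operators are multiples of Pauli strings, then `L` is a
Clifford unitary. The phases are the right ones because `L * P * L⁻¹` has the same square as `P`. -/
lemma mem_cliffordHierarchy_two {L : QubitUnitary K}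
    (h : ∀ P ∈ pauliGroup K, ∃ (c : ℂ) (v : K → ZMod 2 × ZMod 2),
      ((L * P * L⁻¹ * P⁻¹ : QubitUnitary K) : QubitOp K) = c • pauliOp v) :
    L ∈ cliffordHierarchy K 2 := by
  intro P hP
  obtain ⟨c, v, hcv⟩ := h P hP
  obtain ⟨d, hd, t, hdt⟩ := mem_pauliGroup_iff.1 hP
  obtain ⟨e, -, he⟩ := pauliOp_mul v t
  set a := c * d * e with ha
  have hX : ((L * P * L⁻¹ : QubitUnitary K) : QubitOp K) = a • pauliOp (v + t) := by
    rw [← inv_mul_cancel_right (L * P * L⁻¹) P, Submonoid.coe_mul, hcv, hdt, smul_mul_smul_comm,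
      he, smul_smul]
  have hXX : (a * a) • (1 : QubitOp K) = (d * d) • 1 := by
    calc (a * a) • (1 : QubitOp K)
        = ((L * P * L⁻¹ : QubitUnitary K) : QubitOp K) * ((L * P * L⁻¹ : QubitUnitary K) :) := by
          rw [hX, smul_mul_smul_comm, pauliOp_mul_self]
      _ = ((L * (P * P) * L⁻¹ : QubitUnitary K) : QubitOp K) := by
          rw [← Submonoid.coe_mul]
          congr 1; group
      _ = (L : QubitOp K) * ((P : QubitOp K) * P) * ((L⁻¹ : QubitUnitary K) : QubitOp K) := by
          simp only [Submonoid.coe_mul]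
      _ = (d * d) • 1 := by
          rw [hdt, smul_mul_smul_comm, pauliOp_mul_self, mul_smul_comm, mul_one, smul_mul_assoc,
            ← Submonoid.coe_mul, mul_inv_cancel]; rfl
  have hsq : a * a = d * d := by
    have := congrFun (congrFun hXX 0) 0
    simpa using this
  refine mem_pauliGroup_iff.2 ⟨a, ?_, v + t, hX⟩
  rcases mul_self_eq_mul_self_iff.1 hsq with h | h
  · rwa [h]
  · rw [h, ← neg_one_mul d]
    exact phase_mul (a := -1) (by simp) hd

/-- The Clifford hierarchy up to phases, extended by a level `0` of scalars. From level `2` on, the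
levels of the Clifford hierarchy are closed under multiplication by arbitrary phases. -/
def phasedHierarchy (K : Type*) [Fintype K] [DecidableEq K] : ℕ → Set (QubitUnitary K)
  | 0 => {L | ∃ c : ℂ, (L : QubitOp K) = c • 1}
  | 1 => {L | ∃ (c : ℂ) (v : K → ZMod 2 × ZMod 2), (L : QubitOp K) = c • pauliOp v}
  | ℓ + 2 => cliffordHierarchy K (ℓ + 2)

lemma mem_phasedHierarchy_succ {ℓ : ℕ} {L : QubitUnitary K}
    (h : ∀ P ∈ pauliGroup K, L * P * L⁻¹ * P⁻¹ ∈ phasedHierarchy K ℓ) :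
    L ∈ phasedHierarchy K (ℓ + 1) := by
  match ℓ with
  | 0 => exact exists_eq_smul_pauliOp_of_commutator h
  | 1 => exact mem_cliffordHierarchy_two h
  | ℓ + 2 => exact mem_cliffordHierarchy_succ (by omega) h

end Hierarchy

/-! ### Colouring spaces of small Assouad dimension -/

section Colouring

variable {V : Type*} [Fintype V]

/-- One colouring step. Around every point `x` of a net `X` some annulus of width `s` contains at
most a fraction `1 / m` of the points of `T` in a ball of radius `2 * s * m`. The points of `T`
outside these annuli split into `s`-separated cells, labelled by net points, while the points in the
annuli form a set which is sparser than `T` by a factor `N / m`. -/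
lemma exists_sparse_annuli {d : V → V → ℕ} (hsymm : ∀ x y, d x y = d y x)
    (htri : ∀ x y z, d x z ≤ d x y + d y z) {s m N : ℕ} (hm : 0 < m) (X : Finset V)
    (hcover : ∀ v, ∃ x ∈ X, d x v ≤ s * m)
    (hpack : ∀ y, (X.filter fun x => d x y ≤ 4 * (s * m)).card ≤ N)
    (T : Finset V) (a : ℝ) (ha : ∀ x, ((T.filter fun v => d x v ≤ 2 * (s * m)).card : ℝ) ≤ a) :
    ∃ T' ⊆ T, (∀ x, ((T'.filter fun v => d x v ≤ 2 * (s * m)).card : ℝ) ≤ N * a / m) ∧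
      ∃ ℓ : V → V, (∀ v, d (ℓ v) v ≤ 2 * (s * m)) ∧
        ∀ u ∈ T, u ∉ T' → ∀ v ∈ T, v ∉ T' → d u v ≤ s → ℓ u = ℓ v := by
  classical
  let Ann : V → ℕ → Finset V := fun x t =>
    T.filter fun v => s * m + s * t < d x v ∧ d x v ≤ s * m + s * (t + 1)
  have hAnn : ∀ x t, t < m → Ann x t ⊆ T.filter fun v => d x v ≤ 2 * (s * m) := by
    intro x t ht v hv
    simp only [Ann, Finset.mem_filter] at hv ⊢
    have : s * (t + 1) ≤ s * m := Nat.mul_le_mul_left _ ht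
    exact ⟨hv.1, by omega⟩
  have hdisj : ∀ x, Set.PairwiseDisjoint (Finset.range m : Set ℕ) (Ann x) := by
    have key : ∀ x t t', t < t' → Disjoint (Ann x t) (Ann x t') := by
      intro x t t' h
      rw [Finset.disjoint_left]
      intro v hv hv'
      simp only [Ann, Finset.mem_filter] at hv hv'
      have : s * (t + 1) ≤ s * t' := Nat.mul_le_mul_left _ h
      omega
    intro x t _ t' _ hne
    rcases lt_or_gt_of_ne hne with h | h
    · exact key x t t' h
    · exact (key x t' t h).symm
  have hpig : ∀ x, ∃ t < m, (m : ℝ) * ((Ann x t).card : ℝ) ≤ a := by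
    intro x
    by_contra! hcon
    have h1 : ∑ t ∈ Finset.range m, (Ann x t).card ≤
        (T.filter fun v => d x v ≤ 2 * (s * m)).card := by
      rw [← Finset.card_biUnion (hdisj x)]
      exact Finset.card_le_card (Finset.biUnion_subset.2 fun t ht =>
        hAnn x t (Finset.mem_range.1 ht))
    have h2 : ∑ t ∈ Finset.range m, a < ∑ t ∈ Finset.range m, (m : ℝ) * ((Ann x t).card : ℝ) :=
      Finset.sum_lt_sum_of_nonempty ⟨0, Finset.mem_range.2 hm⟩
        fun t ht => hcon t (Finset.mem_range.1 ht)
    rw [← Finset.mul_sum, Finset.sum_const, Finset.card_range, nsmul_eq_mul] at h2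
    have h3 : (∑ t ∈ Finset.range m, ((Ann x t).card : ℝ)) ≤ a := by
      refine le_trans ?_ (ha x)
      exact_mod_cast h1
    have h4 : (0 : ℝ) < m := by exact_mod_cast hm
    exact absurd (lt_of_mul_lt_mul_left h2 h4.le) (not_lt.2 h3)
  choose t ht hta using hpig
  refine ⟨X.biUnion fun x => Ann x (t x), ?_, ?_, ?_⟩
  · exact Finset.biUnion_subset.2 fun x _ => Finset.filter_subset _ _
  · intro y
    have hm0 : (0 : ℝ) < m := by exact_mod_cast hm
    have ha0 : 0 ≤ a := le_trans (by positivity) (ha y)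
    -- Only annuli around the at most `N` net points close to `y` meet the ball around `y`.
    have hsub : ((X.biUnion fun x => Ann x (t x)).filter fun v => d y v ≤ 2 * (s * m)) ⊆
        (X.filter fun x => d x y ≤ 4 * (s * m)).biUnion fun x => Ann x (t x) := by
      intro v hv
      simp only [Finset.mem_filter, Finset.mem_biUnion] at hv ⊢
      obtain ⟨⟨x, hx, hxv⟩, hyv⟩ := hv
      refine ⟨x, ⟨hx, ?_⟩, hxv⟩
      have h1 := (Finset.mem_filter.1 (hAnn x (t x) (ht x) hxv)).2
      have h2 := htri x v y
      rw [hsymm v y] at h2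
      omega
    rw [le_div_iff₀ hm0]
    calc _ ≤ (∑ x ∈ X.filter fun x => d x y ≤ 4 * (s * m), ((Ann x (t x)).card : ℝ)) * m := by
          refine mul_le_mul_of_nonneg_right ?_ hm0.le
          exact_mod_cast (Finset.card_le_card hsub).trans Finset.card_biUnion_le
      _ = ∑ x ∈ X.filter fun x => d x y ≤ 4 * (s * m), (m : ℝ) * ((Ann x (t x)).card : ℝ) := by
          rw [Finset.sum_mul]; exact Finset.sum_congr rfl fun _ _ => mul_comm _ _
      _ ≤ ∑ x ∈ X.filter fun x => d x y ≤ 4 * (s * m), a := Finset.sum_le_sum fun x _ => hta x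
      _ ≤ N * a := by
          rw [Finset.sum_const, nsmul_eq_mul]
          exact mul_le_mul_of_nonneg_right (by exact_mod_cast hpack y) ha0
  · -- The label of `v` is the first net point `x` whose ball of radius `s * m + s * t x`
    -- contains `v`.
    let e := Fintype.equivFin V
    have hmin : ∀ v, ∃ x ∈ X.filter fun x => d x v ≤ s * m + s * t x,
        ∀ x' ∈ X.filter fun x => d x v ≤ s * m + s * t x, e x ≤ e x' := by
      intro v
      refine Finset.exists_min_image _ e ?_
      obtain ⟨x, hx, hxv⟩ := hcover v
      exact ⟨x, Finset.mem_filter.2 ⟨hx, by omega⟩⟩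
    choose ℓ hℓ hℓmin using hmin
    simp only [Finset.mem_filter] at hℓ hℓmin
    refine ⟨ℓ, fun v => ?_, ?_⟩
    · have h1 := (hℓ v).2
      have h2 : s * t (ℓ v) ≤ s * m := Nat.mul_le_mul_left _ (ht _).le
      omega
    · have key : ∀ u v, v ∈ T → v ∉ (X.biUnion fun x => Ann x (t x)) → d u v ≤ s →
          e (ℓ v) ≤ e (ℓ u) := by
        intro u v hv hv' huv
        refine hℓmin v _ ⟨(hℓ u).1, ?_⟩
        by_contra! hlt
        refine hv' (Finset.mem_biUnion.2 ⟨ℓ u, (hℓ u).1, Finset.mem_filter.2 ⟨hv, hlt, ?_⟩⟩)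
        have h1 := htri (ℓ u) u v
        have h2 := (hℓ u).2
        rw [Nat.mul_succ]
        omega
      intro u hu hu' v hv hv' huv
      exact e.injective (le_antisymm (key v u hu hu' (by rwa [hsymm])) (key u v hv hv' huv))

/-- Iterating the colouring step `j` times colours every point, if the initial set contains fewer
than `(m / N) ^ j` points in every ball of radius `2 * s * m`. -/
lemma exists_colouring {d : V → V → ℕ} (hself : ∀ x, d x x = 0) (hsymm : ∀ x y, d x y = d y x)
    (htri : ∀ x y z, d x z ≤ d x y + d y z) {s m N : ℕ} (hm : 0 < m) (X : Finset V)
    (hcover : ∀ v, ∃ x ∈ X, d x v ≤ s * m)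
    (hpack : ∀ y, (X.filter fun x => d x y ≤ 4 * (s * m)).card ≤ N) (j : ℕ) :
    ∀ (T : Finset V) (a : ℝ),
      (∀ x, ((T.filter fun v => d x v ≤ 2 * (s * m)).card : ℝ) ≤ a) →
      (N : ℝ) ^ j * a < (m : ℝ) ^ j →
      ∃ (χ : V → ℕ) (ℓ : V → V), ∀ u ∈ T, χ u < j ∧ d (ℓ u) u ≤ 2 * (s * m) ∧
        ∀ v ∈ T, χ u = χ v → d u v ≤ s → ℓ u = ℓ v := by
  classical
  have hm0 : (0 : ℝ) < m := by exact_mod_cast hm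
  induction j with
  | zero =>
    intro T a ha hlt
    refine ⟨fun _ => 0, id, fun u hu => ?_⟩
    have h1 : 0 < (T.filter fun v => d u v ≤ 2 * (s * m)).card :=
      Finset.card_pos.2 ⟨u, Finset.mem_filter.2 ⟨hu, by rw [hself]; exact Nat.zero_le _⟩⟩
    have h2 : (1 : ℝ) ≤ a := le_trans (by exact_mod_cast h1) (ha u)
    simp only [pow_zero, one_mul] at hlt
    exact absurd hlt (not_lt.2 h2)
  | succ j ih =>
    intro T a ha hlt
    obtain ⟨T', -, hT', ℓ, hℓ, hsep⟩ := exists_sparse_annuli hsymm htri hm X hcover hpack T a ha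
    obtain ⟨χ', ℓ', h'⟩ := ih T' _ hT' (by
      rw [mul_div_assoc', div_lt_iff₀ hm0, ← pow_succ]
      calc (N : ℝ) ^ j * (N * a) = (N : ℝ) ^ (j + 1) * a := by ring
        _ < _ := hlt)
    refine ⟨fun v => if v ∈ T' then χ' v else j, fun v => if v ∈ T' then ℓ' v else ℓ v,
      fun u hu => ?_⟩
    by_cases huT : u ∈ T'
    · obtain ⟨h1, h2, h3⟩ := h' u huT
      simp only [huT, if_true]
      refine ⟨h1.trans (Nat.lt_succ_self j), h2, fun v hv hχ hd => ?_⟩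
      by_cases hvT : v ∈ T'
      · simp only [hvT, if_true] at hχ ⊢
        exact h3 v hvT hχ hd
      · simp only [hvT, if_false] at hχ
        omega
    · simp only [huT, if_false]
      refine ⟨Nat.lt_succ_self j, hℓ u, fun v hv hχ hd => ?_⟩
      by_cases hvT : v ∈ T'
      · have := (h' v hvT).1
        simp only [hvT, if_true] at hχ
        omega
      · simp only [hvT, if_false]
        exact hsep u hu huT v hv hvT hd

end Colouring

/-- A maximal `R`-separated set is an `R`-net. -/
lemma exists_separated_net {V : Type*} [Fintype V] {d : V → V → ℕ} (hself : ∀ x, d x x = 0)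
    (hsymm : ∀ x y, d x y = d y x) (R : ℕ) :
    ∃ X : Finset V, (∀ x ∈ X, ∀ y ∈ X, d x y ≤ R → x = y) ∧ ∀ v, ∃ x ∈ X, d x v ≤ R := by
  classical
  let S : Finset (Finset V) :=
    Finset.univ.filter fun X => ∀ x ∈ X, ∀ y ∈ X, d x y ≤ R → x = y
  obtain ⟨X, hX, hmax⟩ := Finset.exists_max_image S Finset.card ⟨∅, by simp [S]⟩
  have hX' := (Finset.mem_filter.1 hX).2
  refine ⟨X, hX', fun v => ?_⟩
  by_contra! hcon
  have hv : v ∉ X := fun h => by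
    have := hcon v h
    rw [hself] at this
    exact absurd this (Nat.not_lt_zero _)
  have := hmax (insert v X) (by
    refine Finset.mem_filter.2 ⟨Finset.mem_univ _, ?_⟩
    intro x hx y hy hxy
    rw [Finset.mem_insert] at hx hy
    rcases hx with rfl | hx <;> rcases hy with rfl | hy
    · rfl
    · have := hcon y hy
      rw [hsymm] at this
      omega
    · have := hcon x hx
      omega
    · exact hX' x hx y hy hxy)
  rw [Finset.card_insert_of_notMem hv] at this
  omega

/-- The covering condition bounds the number of points in a ball, as a ball of radius `1 / 2` for an
integer-valued metric is a point. -/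
lemma card_ball_le {I : Type*} {V : I → Type*} [∀ i, Fintype (V i)] {d : ∀ i, V i → V i → ℕ}
    (hzero : ∀ i x y, d i x y = 0 → x = y) {α K : ℝ}
    (hK : ∀ (i : I) (x : V i) (r R : ℝ), 0 < r → r < R →
      ∃ F : Finset (V i), (F.card : ℝ) ≤ K * (R / r) ^ α ∧
        ∀ y : V i, (d i x y : ℝ) ≤ R → ∃ z ∈ F, (d i z y : ℝ) ≤ r)
    (i : I) (x : V i) {D : ℕ} (hD : 0 < D) :
    ((Finset.univ.filter fun v => d i x v ≤ D).card : ℝ) ≤ K * (2 * D : ℝ) ^ α := by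
  have hD' : (1 : ℝ) ≤ D := by exact_mod_cast hD
  obtain ⟨F, hF, hcov⟩ := hK i x (1 / 2) D (by norm_num) (by linarith)
  refine le_trans ?_ (hF.trans (le_of_eq ?_))
  · norm_cast
    refine Finset.card_le_card fun v hv => ?_
    obtain ⟨z, hz, hzv⟩ := hcov v (by exact_mod_cast (Finset.mem_filter.1 hv).2)
    have : d i z v = 0 := by
      have : (d i z v : ℝ) < 1 := by linarith
      exact_mod_cast Nat.lt_one_iff.1 (by exact_mod_cast this)
    rwa [← hzero i z v this]
  · congr 2; ring

/-- Spaces with an integer-valued metric which uniformly satisfy the covering condition with an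
exponent `α < n + 1` have, at every scale `s`, a colouring with `n + 1` colours whose monochromatic
`s`-components are uniformly bounded. -/
theorem exists_uniform_colouring {I : Type*} {V : I → Type*} [∀ i, Fintype (V i)]
    {d : ∀ i, V i → V i → ℕ} (hself : ∀ i x, d i x x = 0) (hzero : ∀ i x y, d i x y = 0 → x = y)
    (hsymm : ∀ i x y, d i x y = d i y x) (htri : ∀ i x y z, d i x z ≤ d i x y + d i y z)
    {α : ℝ} {n : ℕ} (hα : α < n + 1)
    (hcov : CoveringCondition (fun i x y => (d i x y : ℝ)) α) {s : ℕ} (hs : 0 < s) :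
    ∃ D : ℕ, ∀ i, ∃ (χ : V i → ℕ) (ℓ : V i → V i), ∀ u, χ u < n + 1 ∧ d i (ℓ u) u ≤ D ∧
      ∀ v, χ u = χ v → d i u v ≤ s → ℓ u = ℓ v := by
  classical
  obtain ⟨K, hK0, hK⟩ := hcov
  obtain ⟨N, hN⟩ := exists_nat_ge (K * (8 : ℝ) ^ α)
  have hs0 : (0 : ℝ) < s := by exact_mod_cast hs
  -- The number of points in a ball of radius `2 * s * m` is `O(m ^ α)`, hence `o(m ^ (n + 1))`.
  obtain ⟨m, hm, hlt⟩ : ∃ m : ℕ, 0 < m ∧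
      (N : ℝ) ^ (n + 1) * (K * (4 * s * m : ℝ) ^ α) < (m : ℝ) ^ (n + 1) := by
    have h1 : Filter.Tendsto (fun m : ℕ => (m : ℝ) ^ (-((n : ℝ) + 1 - α))) Filter.atTop (nhds 0) :=
      (tendsto_rpow_neg_atTop (by linarith)).comp tendsto_natCast_atTop_atTop
    have h2 := (h1.const_mul ((N : ℝ) ^ (n + 1) * (K * (4 * s : ℝ) ^ α))).eventually_lt_const
      (by simp : _ < (1 : ℝ))
    obtain ⟨m, hm, hm0⟩ := (h2.and (Filter.eventually_gt_atTop 0)).exists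
    refine ⟨m, hm0, ?_⟩
    have hm0' : (0 : ℝ) < m := by exact_mod_cast hm0
    have h3 : (m : ℝ) ^ (-((n : ℝ) + 1 - α)) * (m : ℝ) ^ (n + 1) = (m : ℝ) ^ α := by
      rw [← Real.rpow_natCast (m : ℝ) (n + 1), ← Real.rpow_add hm0']
      congr 1; push_cast; ring
    rw [Real.mul_rpow (by positivity) hm0'.le, ← h3]
    calc _ = ((N : ℝ) ^ (n + 1) * (K * (4 * s : ℝ) ^ α) * (m : ℝ) ^ (-((n : ℝ) + 1 - α))) *
          (m : ℝ) ^ (n + 1) := by ring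
      _ < 1 * (m : ℝ) ^ (n + 1) := mul_lt_mul_of_pos_right hm (by positivity)
      _ = _ := one_mul _
  have hsm : 0 < s * m := Nat.mul_pos hs hm
  have hsm' : (0 : ℝ) < (s * m : ℕ) := by exact_mod_cast hsm
  refine ⟨2 * (s * m), fun i => ?_⟩
  obtain ⟨X, hXsep, hXnet⟩ := exists_separated_net (hself i) (hsymm i) (s * m)
  have hpack : ∀ y, (X.filter fun x => d i x y ≤ 4 * (s * m)).card ≤ N := by
    intro y
    obtain ⟨F, hF, hcov⟩ := hK i y ((s * m : ℕ) / 2) (4 * (s * m : ℕ)) (by linarith) (by linarith)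
    have hF' : (F.card : ℝ) ≤ N := by
      refine hF.trans (le_trans (le_of_eq ?_) hN)
      congr 2
      field_simp
      norm_num
    refine le_trans ?_ (by exact_mod_cast hF' : F.card ≤ N)
    have h1 : ∀ x ∈ X.filter fun x => d i x y ≤ 4 * (s * m),
        ∃ z ∈ F, (d i z x : ℝ) ≤ (s * m : ℕ) / 2 := by
      intro x hx
      refine hcov x ?_
      have := (Finset.mem_filter.1 hx).2
      rw [hsymm] at this
      show (d i y x : ℝ) ≤ 4 * (s * m : ℕ)
      exact_mod_cast this
    choose! f hf hfd using h1
    refine Finset.card_le_card_of_injOn f hf ?_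
    intro x hx x' hx' hxx'
    refine hXsep x (Finset.mem_filter.1 hx).1 x' (Finset.mem_filter.1 hx').1 ?_
    have h2 := hfd x hx
    have h3 := hfd x' hx'
    rw [← hxx'] at h3
    have h4 : (d i x x' : ℝ) ≤ d i x (f x) + d i (f x) x' := by exact_mod_cast htri i x (f x) x'
    rw [hsymm i x (f x)] at h4
    have : (d i x x' : ℝ) ≤ (s * m : ℕ) := by linarith
    exact_mod_cast this
  obtain ⟨χ, ℓ, h⟩ := exists_colouring (hself i) (hsymm i) (htri i) hm X hXnet hpack (n + 1)
    Finset.univ (K * (4 * s * m : ℝ) ^ α) (fun x => by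
      refine (card_ball_le hzero hK i x (D := 2 * (s * m)) (by omega)).trans (le_of_eq ?_)
      push_cast
      congr 2; ring) hlt
  exact ⟨χ, ℓ, fun u => ⟨(h u (Finset.mem_univ u)).1, (h u (Finset.mem_univ u)).2.1,
    fun v => (h u (Finset.mem_univ u)).2.2 v (Finset.mem_univ v)⟩⟩

/-! ### Logical gates of codes covered by correctable regions -/

namespace StabilizerCode

variable {Q : Type*} [Fintype Q] [DecidableEq Q] {C : StabilizerCode Q} {k : ℕ}

/-- If the qubits are coloured with the colours `0, …, m` on the support of `O`, and the
`r`-neighbourhoods of the colour classes are correctable, where `2 ^ m` times the spread of `O` is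
at most `r`, then up to a phase `O` acts on the code space as an element of level `m` of the
Clifford hierarchy. A commutator with a Pauli operator eliminates the colour `m` and doubles the
spread. -/
lemma Encoding.Implements.mem_phasedHierarchy (hG : C.connectivityGraph.Connected)
    {E : C.Encoding k} {χ : Q → ℕ} {r : ℕ}
    (hχ : ∀ j, C.Correctable (thick C.connectivityGraph r {q | χ q = j})) (m : ℕ) :
    ∀ (r' : ℕ) (O : QubitUnitary Q) (L : QubitUnitary (Fin k)), 2 ^ m * r' ≤ r →
      Spread C.connectivityGraph r' O → E.Implements O L →
      opSupport (O : QubitOp Q) ⊆ {q | χ q ≤ m} → L ∈ phasedHierarchy (Fin k) m := by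
  induction m with
  | zero =>
    intro r' O L _ _ himp hO
    refine himp.exists_eq_smul_one (hχ 0) (hO.trans ?_)
    exact fun q hq => subset_thick _ _ _ (Nat.le_zero.1 hq)
  | succ m ih =>
    intro r' O L hr hsp himp hO
    have hr' : r' ≤ r := (Nat.le_mul_of_pos_left r' (by positivity)).trans hr
    have hO' : opSupport (O : QubitOp Q) ⊆ {q | χ q ≤ m} ∪ {q | χ q = m + 1} :=
      fun q hq => Nat.le_succ_iff.1 (hO hq)
    refine mem_phasedHierarchy_succ fun P hP => ?_
    obtain ⟨O', hsp', himp', hsupp'⟩ := himp.exists_commutator hG hr' (hχ (m + 1)) hsp hO' hP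
    exact ih (2 * r') O' _ (by rw [← mul_assoc, ← pow_succ]; exact hr) hsp' himp' hsupp'

/-- A code whose qubits are covered by two correctable regions encodes no qubit: a logical Pauli
operator cleaned off one region is supported on the other one, so it is a scalar. -/
lemma eq_zero_of_two_correctable {A B : Set Q} (hA : C.Correctable A) (hB : C.Correctable B)
    (hAB : ∀ q, q ∈ A ∨ q ∈ B) (E : C.Encoding k) : k = 0 := by
  by_contra hk
  let i : Fin k := ⟨0, Nat.pos_of_ne_zero hk⟩
  obtain ⟨P', -, himp, hdisj⟩ := E.exists_pauli_disjoint hA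
    (pauliUnitary_mem (Pi.single i ((1, 0) : ZMod 2 × ZMod 2)))
  obtain ⟨c, hc⟩ := himp.exists_eq_smul_one hB fun q hq =>
    (hAB q).resolve_left (Set.disjoint_left.1 hdisj hq)
  have h1 : (1 : ℂ) • pauliOp (Pi.single i ((1, 0) : ZMod 2 × ZMod 2)) =
      c • pauliOp (0 : Fin k → ZMod 2 × ZMod 2) := by
    rw [one_smul, pauliOp_zero]
    exact hc
  have h2 := congrFun (pauliOp_injective_smul one_ne_zero h1) i
  simp at h2

/-- Neighbourhoods of the colour classes of a colouring are correctable, if the monochromatic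
`(2 * r + 1)`-components are contained in balls of radius `D` and all balls of radius `D + r` have
fewer qubits than the code distance. -/
lemma correctable_thick_colour (hG : C.connectivityGraph.Connected) {r D : ℕ} {χ : Q → ℕ}
    {ℓ : Q → Q} (hℓ : ∀ u, C.connectivityGraph.dist (ℓ u) u ≤ D)
    (hsep : ∀ u v, χ u = χ v → C.connectivityGraph.dist u v ≤ 2 * r + 1 → ℓ u = ℓ v)
    (hball : ∀ x, {q | C.connectivityGraph.dist x q ≤ D + r}.ncard < C.distance) (j : ℕ) :
    C.Correctable (thick C.connectivityGraph r {q | χ q = j}) := by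
  classical
  -- A qubit of the neighbourhood inherits the label of a qubit of the colour class close to it.
  have hnear : ∀ w, ∃ u, w ∈ thick C.connectivityGraph r {q | χ q = j} →
      χ u = j ∧ C.connectivityGraph.dist u w ≤ r := by
    intro w
    by_cases hw : w ∈ thick C.connectivityGraph r {q | χ q = j}
    · obtain ⟨u, hu, hd⟩ := hw
      exact ⟨u, fun _ => ⟨hu, hd⟩⟩
    · exact ⟨w, fun h => (hw h).elim⟩
  choose g hg using hnear
  refine correctable_of_cells (fun w => ℓ (g w)) (fun u hu v hv huv => ?_) fun x => ?_
  · refine hsep _ _ ((hg u hu).1.trans (hg v hv).1.symm) ?_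
    have h1 := hG.dist_triangle (u := g u) (v := u) (w := g v)
    have h2 := hG.dist_triangle (u := u) (v := v) (w := g v)
    have h3 := SimpleGraph.dist_eq_one_iff_adj.2 huv
    have h4 := (hg u hu).2
    have h5 := (hg v hv).2
    rw [SimpleGraph.dist_comm] at h5
    omega
  · refine correctable_of_ncard_lt (lt_of_le_of_lt (Set.ncard_le_ncard ?_ (Set.toFinite _))
      (hball x))
    rintro q ⟨hq, rfl⟩
    have h1 := hG.dist_triangle (u := ℓ (g q)) (v := g q) (w := q)
    have h2 := hℓ (g q)
    have h3 := (hg q hq).2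
    change C.connectivityGraph.dist (ℓ (g q)) q ≤ D + r
    omega

end StabilizerCode

lemma exists_coveringCondition_of_assouadDim_lt {I : Type*} {X : I → Type*}
    {d : ∀ i, X i → X i → ℝ} {b : ℝ≥0∞} (h : assouadDim d < b) :
    ∃ α : ℝ≥0, CoveringCondition d α ∧ (α : ℝ≥0∞) < b := by
  rw [assouadDim, iInf_lt_iff] at h
  obtain ⟨α, hα⟩ := h
  obtain ⟨hcov, hlt⟩ := iInf_lt_iff.1 hα
  exact ⟨α, hcov, hlt⟩

end

theorem mainTheorem2 {I : Type*} {V : I → Type*} [∀ i, Fintype (V i)] [∀ i, DecidableEq (V i)]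
    (C : ∀ i, StabilizerCode (V i))
    (hconn : ∀ i, (C i).connectivityGraph.Connected)
    (β : ℝ) (hβ : 1 ≤ β) (hdim : intrinsicDim C = ENNReal.ofReal β)
    (𝒢 : ∀ i, Set (QubitUnitary (V i))) (h𝒢 : IsGraphLocal C 𝒢) (h : ℕ) :
    ∃ d₀ : ℕ, ∀ i, d₀ ≤ (C i).distance →
      ∀ U : QubitUnitary (V i), HasDepthAtMost (𝒢 i) h U → (C i).IsLogicalGate U →
        ∀ k : ℕ, 1 ≤ k → ∀ E : (C i).Encoding k,
          ∃ L ∈ cliffordHierarchy (Fin k) ⌊β⌋₊, E.Implements U L := by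
  classical
  obtain ⟨η, hη⟩ := h𝒢
  set n := ⌊β⌋₊ with hn
  have hn1 : 1 ≤ n := Nat.one_le_floor_iff β |>.2 hβ
  -- The infimum defining the dimension need not be attained, but it is less than `n + 1`.
  obtain ⟨α, hcov, hα⟩ : ∃ α : ℝ≥0, CoveringCondition
      (fun i u v => ((C i).connectivityGraph.dist u v : ℝ)) α ∧ (α : ℝ) < n + 1 := by
    have hlt : intrinsicDim C < ENNReal.ofReal (n + 1) := by
      rw [hdim]
      exact (ENNReal.ofReal_lt_ofReal_iff (by positivity)).2 (Nat.lt_floor_add_one β)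
    obtain ⟨α, hcov, hα⟩ := exists_coveringCondition_of_assouadDim_lt hlt
    refine ⟨α, hcov, ?_⟩
    rw [← ENNReal.ofReal_coe_nnreal] at hα
    exact (ENNReal.ofReal_lt_ofReal_iff (by positivity)).1 hα
  set r := 2 ^ n * (h * η) with hr
  have hzero : ∀ i (x y : V i), (C i).connectivityGraph.dist x y = 0 → x = y :=
    fun i x y => (hconn i).dist_eq_zero_iff.1
  obtain ⟨D, hD⟩ := exists_uniform_colouring (d := fun i => (C i).connectivityGraph.dist)
    (fun i x => SimpleGraph.dist_self) hzero (fun i x y => SimpleGraph.dist_comm)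
    (fun i x y z => (hconn i).dist_triangle) hα hcov (s := 2 * r + 1) (by omega)
  obtain ⟨K, -, hK⟩ := hcov
  obtain ⟨N, hN⟩ := exists_nat_gt (K * (2 * (D + r + 1 : ℕ) : ℝ) ^ (α : ℝ))
  refine ⟨N, fun i hi U hU hlog k hk E => ?_⟩
  obtain ⟨χ, ℓ, hχ⟩ := hD i
  have hball : ∀ x, {q | (C i).connectivityGraph.dist x q ≤ D + r}.ncard < (C i).distance := by
    intro x
    refine lt_of_lt_of_le ?_ hi
    have h1 := card_ball_le (d := fun i => (C i).connectivityGraph.dist) hzero hK i x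
      (D := D + r + 1) (by omega)
    have h2 : (Finset.univ.filter fun q =>
        (C i).connectivityGraph.dist x q ≤ D + r + 1).card < N := by
      exact_mod_cast h1.trans_lt hN
    refine lt_of_le_of_lt ?_ h2
    rw [← Set.ncard_coe_finset]
    refine Set.ncard_le_ncard (fun q hq => ?_) (Set.toFinite _)
    have hq' : (C i).connectivityGraph.dist x q ≤ D + r := hq
    simp only [Finset.coe_filter, Finset.mem_univ, true_and]
    exact Nat.le_succ_of_le hq'
  have hcorr := StabilizerCode.correctable_thick_colour (hconn i) (fun u => (hχ u).2.1)
    (fun u => (hχ u).2.2) hball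
  obtain ⟨L, hL⟩ := E.exists_implements hlog
  have hsupp : opSupport (U : QubitOp (V i)) ⊆ {q | χ q ≤ n} :=
    fun q _ => Nat.lt_succ_iff.1 (hχ q).1
  refine ⟨L, ?_, hL⟩
  have hlevel := hL.mem_phasedHierarchy (hconn i) hcorr n (h * η) U L le_rfl
    (hU.spread (hconn i) (hη i)) hsupp
  rcases (by omega : n = 1 ∨ 2 ≤ n) with h1 | h2
  · -- Two colours never suffice, so the phase of the logical gate is not an issue.
    have hk0 := StabilizerCode.eq_zero_of_two_correctable
      ((hcorr 0).mono (subset_thick _ _ _)) ((hcorr 1).mono (subset_thick _ _ _))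
      (fun q => by
        have : χ q < n + 1 := (hχ q).1
        change χ q = 0 ∨ χ q = 1
        omega) E
    omega
  · obtain ⟨m, hm⟩ := Nat.exists_eq_add_of_le' h2
    rw [hm] at hlevel ⊢
    exact hlevel
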